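/- Let $\mathbb{X}\subseteq\mathbb{R}^d$ carry the Euclidean metric, let $Q$ be the distribution of a pair $(X,Y)\in\mathbb{X}\times\{+1,-1\}$ with input marginal $Q_X$, and let $f^*(x)=\mathbb{E}[Y\mid X=x]$. Put $\|g\|_Q^2=\int g^2\,dQ_X$. Let $\{f_\theta:\mathbb{X}\to[-1,1]\mid\theta\in\Theta\}$ be a family of measurable functions with $\|f_{\theta_1}-f_{\theta_2}\|_Q\neq 0$ whenever $\theta_1\neq\theta_2$, and let $\theta^*\in\Theta$ satisfy $f_{\theta^*}=f^*$. Let $q<m$ be integers and let $(k_n)$ be a sequence of natural numbers. For sample size $n$, let $(X_i,Y_i)_{i=1}^n$ be i.i.d. from $Q$, let $U_{i,j}$ ($1\le i\le n$, $1\le j\le m-1$) be i.i.d. uniform on $[-1,1]$, and let $\pi$ be a uniformly random permutation of $\{1,\dots,m\}$, all independent. For $\theta\in\Theta$ put $Y_{i,0}(\theta)=Y_i$ and $Y_{i,j}(\theta)=\mathrm{sign}(f_\theta(X_i)+U_{i,j})$ for $1\le j\le m-1$, and for $0\le j\le m-1$ let $$f^{(j)}_{\theta,n}(x)=\frac1{k_n}\sum_{i=1}^n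 Y_{i,j}(\theta)\,\mathbb{I}\big(X_i\in N_n(x,k_n)\big),\qquad Z_n^{(j)}(\theta)=\frac1n\sum_{i=1}^n\big(f_\theta(X_i)-f^{(j)}_{\theta,n}(X_i)\big)^2,$$ where $N_n(x,k)$ is the set of the $k$ points of the sample $X_1,\dots,X_n$ closest to $x$ (ties, which have probability zero below, are broken by the index). Write $Z_n^{(j)}\prec_\pi Z_n^{(l)}$ if $Z_n^{(j)}<Z_n^{(l)}$, or $Z_n^{(j)}=Z_n^{(l)}$ and $\pi(j)<\pi(l)$, with the convention $\pi(0):=\pi(m)$. Let $$\Theta_n^{(2)}=\Big\{\theta\in\Theta\;\Big|\;1+\sum_{j=1}^{m-1}\mathbb{I}\big(Z_n^{(j)}(\theta)\prec_\pi Z_n^{(0)}(\theta)\big)\le q\Big\}.$$ Assume that $k_n/n\to0$ and that $k_n^2/n^{1+\delta}\to\infty$ for some $\delta>0$ as $n\to\infty$, and that $\mathbb{P}\big(\|X-X'\|_2\neq\|X-X''\|_2\big)=1$, where $X',X''$ are independent copies of $X$. Then for every $\theta\in\Theta$ with $\theta\neq\theta^*$ there is an $N_0$ such that for all $n\ge N_0$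 $$\mathbb{P}\big(\theta\notin\Theta_n^{(2)}\big)\;\ge\;1-C_2\,e^{-k_n^2\lambda_2/n},\qquad C_2=4+2(m-1),\quad \lambda_2=\frac{\kappa^4}{2\cdot 48^2},\quad \kappa=\|f_\theta-f^*\|_Q.$$ -/

import Mathlib

open MeasureTheory ProbabilityTheory Filter Topology

namespace KNNResampling

noncomputable section

/-- The discrete σ-algebra on the (finite) set of permutations of `m` objects. -/
instance permMeasurableSpace (m : ℕ) : MeasurableSpace (Equiv.Perm (Fin m)) := ⊤

/-- The uniform distribution on the interval `[-1, 1]`. -/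
def uniformPM : Measure ℝ := ProbabilityTheory.cond volume (Set.Icc (-1 : ℝ) 1)

/-- The uniform distribution on the symmetric group on `m` objects. -/
def uniformPerm (m : ℕ) : Measure (Equiv.Perm (Fin m)) :=
  (PMF.uniformOfFintype (Equiv.Perm (Fin m))).toMeasure

/-- The sign function with values in `{1, -1}`. The convention at `0` is immaterial below: it is
only ever used at `f x + u` with `u` drawn from a distribution without atoms. -/
def sgn (t : ℝ) : ℝ := if 0 ≤ t then 1 else -1

section Distribution

variable {E : Type*} [MeasurableSpace E]

/-- `f` is (a version of) the regression function `x ↦ 𝔼[Y | X = x]` of a distribution `Q`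
of the pair `(X, Y)`. -/
def IsRegressionFunction (Q : Measure (E × ℝ)) (f : E → ℝ) : Prop :=
  Measurable f ∧
    Q[fun z : E × ℝ => z.2 | MeasurableSpace.comap Prod.fst inferInstance]
      =ᵐ[Q] fun z : E × ℝ => f z.1

/-- The squared distance `‖f - g‖²_Q = ∫ (f x - g x)² dQ_X(x)`, where `Q_X` is the marginal
distribution of the inputs. -/
def sqDistQ (Q : Measure (E × ℝ)) (f g : E → ℝ) : ℝ :=
  ∫ x, (f x - g x) ^ 2 ∂Q.fst

/-- The distance `‖f - g‖_Q`. -/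
def distQ (Q : Measure (E × ℝ)) (f g : E → ℝ) : ℝ :=
  Real.sqrt (sqDistQ Q f g)

end Distribution

section Estimator

variable {E : Type*} [PseudoMetricSpace E] {n : ℕ}

/-- `x i` is strictly preferred to `x j` as a neighbour of `z`: it is closer to `z`, or equally
close with a smaller index. -/
def Closer (x : Fin n → E) (z : E) (i j : Fin n) : Prop :=
  dist (x i) z < dist (x j) z ∨ (dist (x i) z = dist (x j) z ∧ i < j)

open Classical in
/-- The indices of the `k` points of `x 1, …, x n` that are closest to `z`: those `i` to which fewer
than `k` sample points are preferred. -/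
def neighbors (k : ℕ) (x : Fin n → E) (z : E) : Finset (Fin n) :=
  {i | (Finset.univ.filter fun j => Closer x z j i).card < k}

/-- The `k`-nearest neighbours estimator
`z ↦ (1 / k) ∑ᵢ yᵢ 𝕀(xᵢ is among the k nearest neighbours of z)`. -/
def knnEstimate (k : ℕ) (x : Fin n → E) (y : Fin n → ℝ) (z : E) : ℝ :=
  (1 / (k : ℝ)) * ∑ i ∈ neighbors k x z, y i

end Estimator

section Ranking

variable {E : Type*} [PseudoMetricSpace E] {n m : ℕ} [NeZero m]

/-- The labels of the `j`-th dataset for the candidate regression function `g`: the original labels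
`y i` for `j = 0`, and the resampled labels `sign (g (x i) + u i j)` for `j = 1, …, m - 1`. -/
def labels (g : E → ℝ) (x : Fin n → E) (y : Fin n → ℝ)
    (u : Fin n → {j : Fin m // j ≠ 0} → ℝ) (j : Fin m) (i : Fin n) : ℝ :=
  if h : j = 0 then y i else sgn (g (x i) + u i ⟨j, h⟩)

/-- The reference variable `Z⁽ʲ⁾ = (1 / n) ∑ᵢ (g (xᵢ) - g⁽ʲ⁾(xᵢ))²`, where `g⁽ʲ⁾` is the
`k`-nearest neighbours estimate computed from the `j`-th dataset. -/
def refVar (k : ℕ) (g : E → ℝ) (x : Fin n → E) (y : Fin n → ℝ)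
    (u : Fin n → {j : Fin m // j ≠ 0} → ℝ) (j : Fin m) : ℝ :=
  (1 / (n : ℝ)) * ∑ i, (g (x i) - knnEstimate k x (labels g x y u j) (x i)) ^ 2

/-- The strict total order on the indices of the values `z 0, …, z (m - 1)`, with ties broken by the
permutation `p`. -/
def Prec (z : Fin m → ℝ) (p : Equiv.Perm (Fin m)) (j l : Fin m) : Prop :=
  z j < z l ∨ (z j = z l ∧ p j < p l)

open Classical in
/-- The rank `1 + ∑_{j = 1}^{m - 1} 𝕀(Z⁽⁰⁾ ≻ Z⁽ʲ⁾)` of the original dataset among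
the `m` datasets. -/
def rank (k : ℕ) (g : E → ℝ) (x : Fin n → E) (y : Fin n → ℝ)
    (u : Fin n → {j : Fin m // j ≠ 0} → ℝ) (p : Equiv.Perm (Fin m)) : ℕ :=
  1 + ∑ j ∈ Finset.univ.filter (fun j : Fin m => j ≠ 0),
    if Prec (refVar k g x y u) p j 0 then 1 else 0

/-- The nearest neighbours based confidence region: the parameters whose rank is at most `q`. -/
def confidenceRegion {Θ : Type*} (f : Θ → E → ℝ) (q k : ℕ) (x : Fin n → E) (y : Fin n → ℝ)
    (u : Fin n → {j : Fin m // j ≠ 0} → ℝ) (p : Equiv.Perm (Fin m)) : Set Θ :=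
  {θ | rank k (f θ) x y u p ≤ q}

end Ranking

/-- The joint law of the randomness of the method for sample size `n` and `m` datasets: an i.i.d.
sample of size `n` from `Q`, i.i.d. variables uniform on `[-1, 1]` indexed by `i = 1, …, n` and
`j = 1, …, m - 1`, and a uniformly distributed permutation, all independent. -/
def experimentLaw {E : Type*} [MeasurableSpace E] (Q : Measure (E × ℝ)) (n m : ℕ) [NeZero m] :
    Measure ((Fin n → E × ℝ) × (Fin n → {j : Fin m // j ≠ 0} → ℝ) × Equiv.Perm (Fin m)) :=
  (Measure.pi fun _ => Q).prod
    ((Measure.pi fun _ => Measure.pi fun _ => uniformPM).prod (uniformPerm m))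

end

end KNNResampling

/-!
The datasets `j ≥ 1` resampled for `θ` have regression function `f θ`, the original one has
`f θ*`. If the nearest neighbours estimate is consistent in empirical mean square with an
exponentially small probability of error, then each `Z⁽ʲ⁾` with `j ≥ 1` is close to `0`, whereas
`Z⁽⁰⁾` stays above `‖f θ - f θ*‖² / 4`; hence the original dataset has rank `m > q`.

The error of the estimate is a bias plus a noise. By Stone's lemma a point is among the `k`
nearest neighbours of at most `γ k` sample points, so smoothing is bounded in mean square and a
regression function may be replaced by a continuous `g`; the bias of `g` is small at the points of
finitely many balls on which `g` hardly oscillates, apart from the few balls with fewer than `k`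
sample points. Given the inputs, the noise at a sample point is an average of `k` independent
centred bounded variables, and a union bound over the `n` sample points costs a factor `n`, which
is absorbed because `log n = o(k)`. All this leaves a probability of error of order `e^{-c k}`,
which is eventually below `e^{-λ k² / n}` for every `λ` since `k / n → 0`.
-/

namespace KNNResampling

open scoped Finset

section Neighbors

variable {E : Type*} [PseudoMetricSpace E] {n k : ℕ} {x : Fin n → E} {z : E} {i j : Fin n}

theorem card_filter_card_filter_lt_lt {ι α : Type*} [Fintype ι] [LinearOrder α] {key : ι → α}
    (hkey : Function.Injective key) (k : ℕ) :
    #{i | #{j | key j < key i} < k} = min k (Fintype.card ι) := by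
  classical
  let e : Fin (Fintype.card ι) ≃o Set.range key :=
    Fintype.orderIsoFinOfCardEq _ (Set.card_range_of_injective hkey)
  let σ : Fin (Fintype.card ι) ≃ ι := e.toEquiv.trans (Equiv.ofInjective key hkey).symm
  have hσ (a b) : key (σ a) < key (σ b) ↔ a < b := by
    have key_σ (c) : key (σ c) = e c := Equiv.apply_ofInjective_symm hkey (e c)
    rw [key_σ, key_σ, Subtype.coe_lt_coe, e.lt_iff_lt]
  have rank_σ (a) : #{j | key j < key (σ a)} = (a : ℕ) := by
    rw [← Fin.card_Iio a]
    exact (Finset.card_equiv σ fun b => by simp [hσ]).symm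
  rw [min_comm, ← Fin.card_filter_val_lt]
  exact (Finset.card_equiv σ fun a => by simp [rank_σ]).symm

theorem closer_iff_toLex_lt :
    Closer x z i j ↔ toLex (dist (x i) z, i) < toLex (dist (x j) z, j) := by
  rw [Closer, Prod.Lex.toLex_lt_toLex]

open Classical in
theorem mem_neighbors : i ∈ neighbors k x z ↔ #{j | Closer x z j i} < k := by
  simp only [neighbors, Finset.mem_filter_univ]

theorem card_neighbors_eq_min (k : ℕ) (x : Fin n → E) (z : E) :
    #(neighbors k x z) = min k n := by
  have hinj : Function.Injective fun i => toLex (dist (x i) z, i) := fun i j h =>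
    (Prod.ext_iff.1 (toLex_inj.1 h)).2
  trans min k (Fintype.card (Fin n))
  · rw [← card_filter_card_filter_lt_lt hinj k]
    congr 1
    ext i
    simp only [mem_neighbors, closer_iff_toLex_lt, Finset.mem_filter_univ]
  · rw [Fintype.card_fin]

theorem card_neighbors_le (k : ℕ) (x : Fin n → E) (z : E) : #(neighbors k x z) ≤ k :=
  (card_neighbors_eq_min k x z).trans_le (min_le_left k n)

theorem card_neighbors (hk : k ≤ n) (x : Fin n → E) (z : E) : #(neighbors k x z) = k :=
  (card_neighbors_eq_min k x z).trans (min_eq_left hk)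

open Classical in
theorem exists_dist_le_of_mem_neighbors {s : Finset (Fin n)} (hs : k ≤ #s)
    (hj : j ∈ neighbors k x z) : ∃ i ∈ s, dist (x j) z ≤ dist (x i) z := by
  by_contra! hlt
  refine (hs.trans (Finset.card_le_card fun i hi => ?_)).not_gt (mem_neighbors.1 hj)
  exact Finset.mem_filter_univ i |>.2 (Or.inl (hlt i hi))

end Neighbors

section Stone

/-- `γ` is an admissible constant in **Stone's lemma** for the space `E`: a point of a sample
without repetitions is among the `k` nearest neighbours of at most `γ k` sample points. -/
def IsStoneBound (E : Type*) [PseudoMetricSpace E] (γ : ℕ) : Prop :=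
  ∀ ⦃n : ℕ⦄ (k : ℕ) (x : Fin n → E), Function.Injective x → ∀ j,
    #{i | j ∈ neighbors k x (x i)} ≤ γ * k

theorem IsStoneBound.subtype {E : Type*} [PseudoMetricSpace E] {γ : ℕ} (hγ : IsStoneBound E γ)
    (s : Set E) : IsStoneBound s γ :=
  fun _ k x hx => hγ k (fun i => (x i : E)) (Subtype.val_injective.comp hx)

variable {V : Type*} [NormedAddCommGroup V] [NormedSpace ℝ V]

theorem norm_sub_lt_of_norm_sub_directions_lt_one {a b : V} (ha : a ≠ 0) (hb : b ≠ 0)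
    (hdir : ‖‖a‖⁻¹ • a - ‖b‖⁻¹ • b‖ < 1) (hab : ‖a‖ ≤ ‖b‖) : ‖a - b‖ < ‖b‖ := by
  have hdec : a - b = ‖a‖ • (‖a‖⁻¹ • a - ‖b‖⁻¹ • b) - (‖b‖ - ‖a‖) • ‖b‖⁻¹ • b := by
    rw [smul_sub, smul_inv_smul₀ (norm_ne_zero_iff.2 ha), sub_smul,
      smul_inv_smul₀ (norm_ne_zero_iff.2 hb)]
    abel
  calc ‖a - b‖ ≤ ‖‖a‖ • (‖a‖⁻¹ • a - ‖b‖⁻¹ • b)‖ + ‖(‖b‖ - ‖a‖) • ‖b‖⁻¹ • b‖ := by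
        rw [hdec]; exact norm_sub_le _ _
    _ = ‖a‖ * ‖‖a‖⁻¹ • a - ‖b‖⁻¹ • b‖ + (‖b‖ - ‖a‖) := by
        rw [norm_smul, norm_norm, norm_smul, norm_smul, norm_inv, norm_norm,
          inv_mul_cancel₀ (norm_ne_zero_iff.2 hb), mul_one,
          Real.norm_of_nonneg (sub_nonneg.2 hab)]
    _ < ‖a‖ * 1 + (‖b‖ - ‖a‖) := by gcongr
    _ = ‖b‖ := by ring

theorem card_le_of_norm_sub_directions_lt_one {n k : ℕ} {x : Fin n → V}
    (hx : Function.Injective x) {j : Fin n} {s : Finset (Fin n)}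
    (hs : ∀ i ∈ s, i ≠ j ∧ j ∈ neighbors k x (x i))
    (hdir : ∀ i ∈ s, ∀ l ∈ s,
      ‖‖x i - x j‖⁻¹ • (x i - x j) - ‖x l - x j‖⁻¹ • (x l - x j)‖ < 1) :
    #s ≤ k := by
  classical
  rcases s.eq_empty_or_nonempty with rfl | hne
  · simp
  -- All other points of the cone `s` are preferred to the apex `x j` by its farthest point `x l`.
  obtain ⟨l, hl, hmax⟩ := s.exists_max_image (fun i => ‖x i - x j‖) hne
  refine (Finset.card_le_card fun i hi => ?_).trans (mem_neighbors.1 (hs l hl).2).le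
  have sub_ne_zero {i} (hi : i ∈ s) : x i - x j ≠ 0 := sub_ne_zero.2 (hx.ne (hs i hi).1)
  have hlt := norm_sub_lt_of_norm_sub_directions_lt_one (sub_ne_zero hi) (sub_ne_zero hl)
    (hdir i hi l hl) (hmax i hi)
  rw [sub_sub_sub_cancel_right, ← dist_eq_norm, ← dist_eq_norm, dist_comm (x l)] at hlt
  exact Finset.mem_filter_univ i |>.2 (Or.inl hlt)

theorem exists_isStoneBound (V : Type*) [NormedAddCommGroup V] [NormedSpace ℝ V]
    [FiniteDimensional ℝ V] : ∃ γ, IsStoneBound V γ := by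
  classical
  have : ProperSpace V := FiniteDimensional.proper ℝ V
  obtain ⟨t, -, ht, hcover⟩ := (isCompact_sphere (0 : V) 1).finite_cover_balls (half_pos one_pos)
  lift t to Finset V using ht
  refine ⟨#t + 1, fun n k x hx j => ?_⟩
  rcases k.eq_zero_or_pos with rfl | hk
  · simp [mem_neighbors]
  let dir (i : Fin n) : V := ‖x i - x j‖⁻¹ • (x i - x j)
  let cone (c : V) : Finset (Fin n) :=
    {i | (i ≠ j ∧ j ∈ neighbors k x (x i)) ∧ dir i ∈ Metric.ball c (1 / 2)}
  have hcone (c : V) : #(cone c) ≤ k := by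
    refine card_le_of_norm_sub_directions_lt_one hx (fun i hi => (Finset.mem_filter.1 hi).2.1)
      fun i hi l hl => ?_
    rw [← dist_eq_norm, ← add_halves (1 : ℝ)]
    exact (dist_triangle_right _ _ c).trans_lt
      (add_lt_add (Finset.mem_filter.1 hi).2.2 (Finset.mem_filter.1 hl).2.2)
  have hsub : ({i | j ∈ neighbors k x (x i)} : Finset (Fin n)) ⊆
      insert j (t.biUnion cone) := fun i hi => by
    refine Finset.mem_insert.2 (or_iff_not_imp_left.2 fun hij => ?_)
    have hdir : dir i ∈ Metric.sphere (0 : V) 1 :=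
      mem_sphere_zero_iff_norm.2 (norm_smul_inv_norm (sub_ne_zero.2 (hx.ne hij)))
    obtain ⟨c, hc, hic⟩ := Set.mem_iUnion₂.1 (hcover hdir)
    exact Finset.mem_biUnion.2
      ⟨c, hc, Finset.mem_filter_univ i |>.2 ⟨⟨hij, Finset.mem_filter_univ i |>.1 hi⟩, hic⟩⟩
  calc _ ≤ #(t.biUnion cone) + 1 := (Finset.card_le_card hsub).trans (Finset.card_insert_le _ _)
    _ ≤ #t * k + 1 := by gcongr; exact Finset.card_biUnion_le_card_mul _ _ _ fun c _ => hcone c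
    _ ≤ (#t + 1) * k := by rw [add_one_mul]; gcongr; exact hk

end Stone

section MeanSq

variable {n : ℕ}

/-- The mean square `(1 / n) ∑ᵢ vᵢ²` of a finite sequence. It is `0` for the empty sequence. -/
noncomputable def meanSq (v : Fin n → ℝ) : ℝ :=
  (1 / (n : ℝ)) * ∑ i, v i ^ 2

theorem meanSq_add_le (v w : Fin n → ℝ) : meanSq (v + w) ≤ 2 * meanSq v + 2 * meanSq w := by
  calc meanSq (v + w) ≤ (1 / (n : ℝ)) * ∑ i, (2 * v i ^ 2 + 2 * w i ^ 2) := by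
        unfold meanSq
        gcongr with i
        exact add_sq_le.trans_eq (mul_add _ _ _)
    _ = 2 * meanSq v + 2 * meanSq w := by
        rw [Finset.sum_add_distrib, ← Finset.mul_sum, ← Finset.mul_sum, meanSq, meanSq]; ring

theorem meanSq_sub_le (v w : Fin n → ℝ) : meanSq (v - w) ≤ 2 * meanSq v + 2 * meanSq w := by
  simpa only [sub_eq_add_neg, meanSq, Pi.neg_apply, neg_sq] using meanSq_add_le v (-w)

theorem meanSq_le_sq_add {v : Fin n → ℝ} {a b : ℝ} {B : Finset (Fin n)}
    (ha : ∀ i ∉ B, |v i| ≤ a) (hb : ∀ i, |v i| ≤ b) :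
    meanSq v ≤ a ^ 2 + b ^ 2 * (#B / n) := by
  rcases n.eq_zero_or_pos with rfl | hn
  · simpa [meanSq] using sq_nonneg a
  have hle (i : Fin n) : v i ^ 2 ≤ a ^ 2 + if i ∈ B then b ^ 2 else 0 := by
    split_ifs with hi
    · exact (sq_le_sq.2 ((hb i).trans (le_abs_self b))).trans (le_add_of_nonneg_left (sq_nonneg a))
    · exact (sq_le_sq.2 ((ha i hi).trans (le_abs_self a))).trans_eq (add_zero _).symm
  calc meanSq v ≤ (1 / (n : ℝ)) * ∑ i, (a ^ 2 + if i ∈ B then b ^ 2 else 0) := by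
        unfold meanSq; gcongr with i; exact hle i
    _ = a ^ 2 + b ^ 2 * (#B / n) := by
        rw [Finset.sum_add_distrib, Finset.sum_ite_mem, Finset.univ_inter]
        simp only [Finset.sum_const, Finset.card_univ, Fintype.card_fin, nsmul_eq_mul]
        field_simp

theorem meanSq_le_sq {v : Fin n → ℝ} {a : ℝ} (ha : ∀ i, |v i| ≤ a) : meanSq v ≤ a ^ 2 := by
  simpa using meanSq_le_sq_add (B := ∅) (fun i _ => ha i) ha

end MeanSq

section Smoothing

variable {E : Type*} [PseudoMetricSpace E] {n k γ : ℕ} {x : Fin n → E}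

/-- The nearest neighbours smoother: the nearest neighbours estimate of the labels `y`, evaluated
at the sample points themselves. -/
noncomputable def smooth (k : ℕ) (x : Fin n → E) (y : Fin n → ℝ) : Fin n → ℝ :=
  fun i => knnEstimate k x y (x i)

theorem smooth_sub (k : ℕ) (x : Fin n → E) (y y' : Fin n → ℝ) :
    smooth k x (y - y') = smooth k x y - smooth k x y' := by
  ext i
  simp only [smooth, knnEstimate, Pi.sub_apply, Finset.sum_sub_distrib, mul_sub]

theorem sq_knnEstimate_le (k : ℕ) (x : Fin n → E) (v : Fin n → ℝ) (z : E) :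
    knnEstimate k x v z ^ 2 ≤ (1 / (k : ℝ)) * ∑ j ∈ neighbors k x z, v j ^ 2 := by
  calc knnEstimate k x v z ^ 2
      ≤ (1 / (k : ℝ)) ^ 2 * (#(neighbors k x z) * ∑ j ∈ neighbors k x z, v j ^ 2) := by
        rw [knnEstimate, mul_pow]; gcongr; exact sq_sum_le_card_mul_sum_sq
    _ ≤ (1 / (k : ℝ)) ^ 2 * (k * ∑ j ∈ neighbors k x z, v j ^ 2) := by
        gcongr; exact card_neighbors_le k x z
    _ = (1 / (k : ℝ)) * ∑ j ∈ neighbors k x z, v j ^ 2 := by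
        rcases eq_or_ne (k : ℝ) 0 with hk | hk
        · simp [hk]
        · field_simp

theorem meanSq_smooth_le (hγ : IsStoneBound E γ) (hx : Function.Injective x) (v : Fin n → ℝ) :
    meanSq (smooth k x v) ≤ γ * meanSq v := by
  suffices ∑ i, smooth k x v i ^ 2 ≤ γ * ∑ j, v j ^ 2 by
    rw [meanSq, meanSq, mul_left_comm]; gcongr
  calc ∑ i, smooth k x v i ^ 2
      ≤ ∑ i, (1 / (k : ℝ)) * ∑ j ∈ neighbors k x (x i), v j ^ 2 :=
        Finset.sum_le_sum fun i _ => sq_knnEstimate_le k x v (x i)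
    _ = (1 / (k : ℝ)) * ∑ j, #{i | j ∈ neighbors k x (x i)} * v j ^ 2 := by
        rw [← Finset.mul_sum, Finset.sum_comm' (t' := Finset.univ)
          (s' := fun j => {i | j ∈ neighbors k x (x i)}) (by simp)]
        simp only [Finset.sum_const, nsmul_eq_mul]
    _ ≤ (1 / (k : ℝ)) * ∑ j, γ * k * v j ^ 2 := by
        gcongr with j; exact_mod_cast hγ k x hx j
    _ = (k / k : ℝ) * (γ * ∑ j, v j ^ 2) := by rw [← Finset.mul_sum]; ring
    _ ≤ γ * ∑ j, v j ^ 2 := mul_le_of_le_one_left (by positivity) (div_self_le_one _)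

theorem abs_sub_knnEstimate_le (hk : 0 < k) (hkn : k ≤ n) {v : Fin n → ℝ} {z : E} {a τ : ℝ}
    (h : ∀ j ∈ neighbors k x z, |a - v j| ≤ τ) : |a - knnEstimate k x v z| ≤ τ := by
  have hk' : (0 : ℝ) < k := by exact_mod_cast hk
  have hcard := card_neighbors hkn x z
  have hdiff : a - knnEstimate k x v z = (1 / (k : ℝ)) * ∑ j ∈ neighbors k x z, (a - v j) := by
    rw [Finset.sum_sub_distrib, Finset.sum_const, hcard, nsmul_eq_mul, knnEstimate]
    field_simp
  calc |a - knnEstimate k x v z|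
      ≤ (1 / (k : ℝ)) * ∑ j ∈ neighbors k x z, |a - v j| := by
        rw [hdiff, abs_mul, abs_of_pos (one_div_pos.2 hk')]
        gcongr
        exact Finset.abs_sum_le_sum_abs _ _
    _ ≤ (1 / (k : ℝ)) * (#(neighbors k x z) • τ) := by
        gcongr; exact Finset.sum_le_card_nsmul _ _ _ h
    _ = τ := by rw [hcard, nsmul_eq_mul]; field_simp

/-- The part of the labels `y` that the nearest neighbours smoother fails to reproduce. For
`y = h ∘ x` it is the bias of the nearest neighbours estimate of `h`. -/
noncomputable def residual (k : ℕ) (x : Fin n → E) (y : Fin n → ℝ) : Fin n → ℝ :=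
  y - smooth k x y

theorem meanSq_residual_le (hγ : IsStoneBound E γ) (hx : Function.Injective x)
    (v w : Fin n → ℝ) :
    meanSq (residual k x v) ≤ 2 * meanSq (residual k x w) + 4 * (1 + γ) * meanSq (v - w) := by
  have hdecomp : residual k x v = residual k x w + ((v - w) - smooth k x (v - w)) := by
    rw [smooth_sub, residual, residual]; abel
  linarith [hdecomp ▸ meanSq_add_le (residual k x w) _, meanSq_sub_le (v - w) (smooth k x (v - w)),
    meanSq_smooth_le (k := k) hγ hx (v - w)]

theorem meanSq_residual_comp_le (hk : 0 < k) (hkn : k ≤ n) {g : E → ℝ} {M τ : ℝ}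
    (hM : ∀ z, |g z| ≤ M) {B : Finset (Fin n)}
    (hB : ∀ i ∉ B, ∀ j ∈ neighbors k x (x i), |g (x i) - g (x j)| ≤ τ) :
    meanSq (residual k x (g ∘ x)) ≤ τ ^ 2 + (2 * M) ^ 2 * (#B / n) :=
  meanSq_le_sq_add (fun i hi => abs_sub_knnEstimate_le hk hkn (hB i hi)) fun _ =>
    abs_sub_knnEstimate_le hk hkn fun _ _ => (abs_sub _ _).trans
      ((add_le_add (hM _) (hM _)).trans_eq (two_mul M).symm)

theorem meanSq_sub_smooth_le (h : E → ℝ) (x : Fin n → E) (y : Fin n → ℝ) :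
    meanSq (h ∘ x - smooth k x y) ≤
      2 * meanSq (residual k x (h ∘ x)) + 2 * meanSq (smooth k x (y - h ∘ x)) := by
  refine le_of_eq_of_le (congrArg meanSq ?_) (meanSq_sub_le _ _)
  rw [smooth_sub, residual]; abel

end Smoothing

section ExpDecay

/-- The sequence `p` is bounded above by `C e^{- c rₙ}` for large `n`, with constants `c, C > 0`. -/
def ExpDecay (r : ℕ → ℕ) (p : ℕ → ℝ) : Prop :=
  ∃ c : ℝ, 0 < c ∧ ∃ C : ℝ, 0 < C ∧ ∀ᶠ n in atTop, p n ≤ C * Real.exp (-(c * r n))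

namespace ExpDecay

variable {r r' : ℕ → ℕ} {p p' : ℕ → ℝ}

theorem mono (hp : ExpDecay r p) (h : ∀ᶠ n in atTop, p' n ≤ p n) : ExpDecay r p' := by
  obtain ⟨c, hc, C, hC, hle⟩ := hp
  exact ⟨c, hc, C, hC, by filter_upwards [h, hle] with n using le_trans⟩

theorem mono_rate (hp : ExpDecay r p) (h : ∀ᶠ n in atTop, r' n ≤ r n) : ExpDecay r' p := by
  obtain ⟨c, hc, C, hC, hle⟩ := hp
  refine ⟨c, hc, C, hC, ?_⟩
  filter_upwards [h, hle] with n hr hn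
  exact hn.trans (by gcongr)

theorem zero : ExpDecay r fun _ => 0 :=
  ⟨1, one_pos, 1, one_pos, .of_forall fun _ => by positivity⟩

theorem add (hp : ExpDecay r p) (hp' : ExpDecay r p') : ExpDecay r fun n => p n + p' n := by
  obtain ⟨c, hc, C, hC, hle⟩ := hp
  obtain ⟨c', hc', C', hC', hle'⟩ := hp'
  refine ⟨min c c', lt_min hc hc', C + C', add_pos hC hC', ?_⟩
  filter_upwards [hle, hle'] with n hn hn'
  calc p n + p' n ≤ C * Real.exp (-(c * r n)) + C' * Real.exp (-(c' * r n)) := add_le_add hn hn'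
    _ ≤ C * Real.exp (-(min c c' * r n)) + C' * Real.exp (-(min c c' * r n)) := by
        gcongr <;> simp
    _ = (C + C') * Real.exp (-(min c c' * r n)) := (add_mul _ _ _).symm

theorem sum {ι : Type*} {s : Finset ι} {p : ι → ℕ → ℝ} (hp : ∀ i ∈ s, ExpDecay r (p i)) :
    ExpDecay r fun n => ∑ i ∈ s, p i n := by
  classical
  induction s using Finset.induction_on with
  | empty => simpa only [Finset.sum_empty] using zero
  | insert i s hi ih =>
    simp only [Finset.sum_insert hi]
    exact (hp i (Finset.mem_insert_self i s)).add
      (ih fun j hj => hp j (Finset.mem_insert_of_mem hj))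

theorem natCast_mul (hp : ExpDecay r p)
    (hr : (fun n : ℕ => Real.log n) =o[atTop] fun n => (r n : ℝ)) :
    ExpDecay r fun n => n * p n := by
  obtain ⟨c, hc, C, hC, hle⟩ := hp
  refine ⟨c / 2, half_pos hc, C, hC, ?_⟩
  filter_upwards [hle, hr.bound (half_pos hc), eventually_gt_atTop 0] with n hn hlog hpos
  have hlog' : Real.log n ≤ c / 2 * r n := by
    simpa using (le_abs_self _).trans hlog
  calc n * p n ≤ n * (C * Real.exp (-(c * r n))) := by gcongr
    _ = C * Real.exp (Real.log n - c * r n) := by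
        rw [sub_eq_add_neg, Real.exp_add, Real.exp_log (by exact_mod_cast hpos)]; ring
    _ ≤ C * Real.exp (-(c / 2 * r n)) := by gcongr; linarith

theorem eventually_le_exp (hp : ExpDecay r p) (hr : Tendsto r atTop atTop) :
    ∃ c : ℝ, 0 < c ∧ ∀ᶠ n in atTop, p n ≤ Real.exp (-(c * r n)) := by
  obtain ⟨c, hc, C, hC, hle⟩ := hp
  refine ⟨c / 2, half_pos hc, ?_⟩
  have hlim : Tendsto (fun n => c / 2 * (r n : ℝ)) atTop atTop :=
    (tendsto_natCast_atTop_atTop.comp hr).const_mul_atTop (half_pos hc)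
  filter_upwards [hle, hlim.eventually_ge_atTop (Real.log C)] with n hn hlog
  calc p n ≤ C * Real.exp (-(c * r n)) := hn
    _ = Real.exp (Real.log C - c * r n) := by
        rw [sub_eq_add_neg, Real.exp_add, Real.exp_log hC]
    _ ≤ Real.exp (-(c / 2 * r n)) := by gcongr; linarith

variable {Ω : ℕ → Type*} {mΩ : ∀ n, MeasurableSpace (Ω n)} {μ : ∀ n, Measure (Ω n)}
  {S T : ∀ n, Set (Ω n)}

theorem measureReal_mono_ae [∀ n, IsFiniteMeasure (μ n)]
    (hS : ExpDecay r fun n => (μ n).real (S n))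
    (h : ∀ᶠ n in atTop, ∀ᵐ ω ∂μ n, ω ∈ T n → ω ∈ S n) :
    ExpDecay r fun n => (μ n).real (T n) :=
  hS.mono <| h.mono fun _ hn => ENNReal.toReal_mono (measure_ne_top _ _) (measure_mono_ae hn)

theorem measureReal_union (hS : ExpDecay r fun n => (μ n).real (S n))
    (hT : ExpDecay r fun n => (μ n).real (T n)) :
    ExpDecay r fun n => (μ n).real (S n ∪ T n) :=
  (hS.add hT).mono (.of_forall fun n => measureReal_union_le (S n) (T n))

end ExpDecay

end ExpDecay

section SampleLaw

variable {α : Type*} [MeasurableSpace α]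

/-- The law of an i.i.d. sample of size `n` from `ν`. -/
noncomputable abbrev sampleLaw (ν : Measure α) (n : ℕ) : Measure (Fin n → α) :=
  Measure.pi fun _ => ν

variable {ν : Measure α} [IsProbabilityMeasure ν] {n : ℕ}

theorem ae_sampleLaw_forall {p : α → Prop} (h : ∀ᵐ a ∂ν, p a) :
    ∀ᵐ x ∂sampleLaw ν n, ∀ i, p (x i) :=
  ae_all_iff.2 fun i =>
    (measurePreserving_eval (fun _ : Fin n => ν) i).quasiMeasurePreserving.ae h

theorem measureReal_sampleLaw_le_mean_le {φ : α → ℝ} (hφ : AEMeasurable φ ν) {a b : ℝ}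
    (hab : ∀ᵐ s ∂ν, φ s ∈ Set.Icc a b) {t : ℝ} (ht : 0 ≤ t) :
    (sampleLaw ν n).real {x | ∫ s, φ s ∂ν + t ≤ (1 / (n : ℝ)) * ∑ i, φ (x i)} ≤
      Real.exp (-(2 * t ^ 2 / (b - a) ^ 2 * n)) := by
  rcases n.eq_zero_or_pos with rfl | hn
  · simp
  let ξ (s : α) : ℝ := φ s - ∫ s, φ s ∂ν
  have hξ (i : Fin n) :
      HasSubgaussianMGF (fun x : Fin n → α => ξ (x i)) ((‖b - a‖₊ / 2) ^ 2) (sampleLaw ν n) := by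
    have heval := measurePreserving_eval (fun _ : Fin n => ν) i
    refine HasSubgaussianMGF.of_map (X := ξ) heval.measurable.aemeasurable ?_
    rw [heval.map_eq]
    exact hasSubgaussianMGF_of_mem_Icc hφ hab
  have hindep : iIndepFun (fun i (x : Fin n → α) => ξ (x i)) (sampleLaw ν n) :=
    iIndepFun_pi fun _ => hφ.sub_const _
  have hevent : {x : Fin n → α | ∫ s, φ s ∂ν + t ≤ (1 / (n : ℝ)) * ∑ i, φ (x i)} =
      {x | n * t ≤ ∑ i, ξ (x i)} := by
    ext x
    have : (0 : ℝ) < n := by exact_mod_cast hn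
    simp only [Set.mem_ofPred_eq, ξ, Finset.sum_sub_distrib, Finset.sum_const, Finset.card_univ,
      Fintype.card_fin, nsmul_eq_mul, one_div, ← div_eq_inv_mul, le_div_iff₀ this,
      le_sub_iff_add_le]
    rw [← mul_add, mul_comm, add_comm t]
  rw [hevent]
  refine (HasSubgaussianMGF.measure_sum_ge_le_of_iIndepFun hindep (fun i _ => hξ i)
    (by positivity)).trans_eq ?_
  congr 1
  simp only [Finset.sum_const, Finset.card_univ, Fintype.card_fin, nsmul_eq_mul, NNReal.coe_mul,
    NNReal.coe_natCast, NNReal.coe_pow, NNReal.coe_div, coe_nnnorm, NNReal.coe_ofNat,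
    Real.norm_eq_abs, div_pow, sq_abs]
  rcases eq_or_ne (b - a) 0 with h | h
  · simp [h]
  · field_simp

theorem expDecay_le_mean {φ : α → ℝ} (hφ : AEMeasurable φ ν) {a b : ℝ}
    (hab : ∀ᵐ s ∂ν, φ s ∈ Set.Icc a b) {δ : ℝ} (hδ : ∫ s, φ s ∂ν < δ) :
    ExpDecay id fun n => (sampleLaw ν n).real {x | δ ≤ (1 / (n : ℝ)) * ∑ i, φ (x i)} := by
  -- Widening `[a, b]` excludes a division by `0` in the exponent.
  have hab' : ∀ᵐ s ∂ν, φ s ∈ Set.Icc a (max b (a + 1)) :=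
    hab.mono fun s hs => ⟨hs.1, hs.2.trans (le_max_left _ _)⟩
  have hpos : 0 < max b (a + 1) - a := by linarith [le_max_right b (a + 1)]
  have ht := sub_pos.2 hδ
  refine ⟨2 * (δ - ∫ s, φ s ∂ν) ^ 2 / (max b (a + 1) - a) ^ 2, by positivity, 1, one_pos,
    .of_forall fun n => ?_⟩
  simpa only [add_sub_cancel, one_mul, id] using
    measureReal_sampleLaw_le_mean_le (n := n) hφ hab' ht.le

theorem expDecay_le_meanSq {w : α → ℝ} (hw : AEMeasurable w ν) {M : ℝ}
    (hM : ∀ᵐ s ∂ν, |w s| ≤ M) {δ : ℝ} (hδ : ∫ s, w s ^ 2 ∂ν < δ) :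
    ExpDecay id fun n => (sampleLaw ν n).real {x | δ ≤ meanSq (w ∘ x)} :=
  expDecay_le_mean (hw.pow_const 2)
    (hM.mono fun _ hs => ⟨sq_nonneg _, sq_le_sq.2 (hs.trans (le_abs_self M))⟩) hδ

theorem expDecay_meanSq_le {w : α → ℝ} (hw : AEMeasurable w ν) {M : ℝ}
    (hM : ∀ᵐ s ∂ν, |w s| ≤ M) {δ : ℝ} (hδ : δ < ∫ s, w s ^ 2 ∂ν) :
    ExpDecay id fun n => (sampleLaw ν n).real {x | meanSq (w ∘ x) ≤ δ} := by
  have h := expDecay_le_mean (φ := fun s => -w s ^ 2) (a := -M ^ 2) (b := 0) (hw.pow_const 2).neg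
    (hM.mono fun _ hs => ⟨neg_le_neg (sq_le_sq.2 (hs.trans (le_abs_self M))),
      neg_nonpos.2 (sq_nonneg _)⟩) (δ := -δ) (by rwa [integral_neg, neg_lt_neg_iff])
  simpa only [Finset.sum_neg_distrib, mul_neg, neg_le_neg_iff, meanSq, Function.comp_apply] using h

theorem expDecay_le_card_div {s : Set α} [DecidablePred (· ∈ s)] (hs : MeasurableSet s) {δ : ℝ}
    (hδ : ν.real s < δ) :
    ExpDecay id fun n => (sampleLaw ν n).real {x : Fin n → α | δ ≤ #{i | x i ∈ s} / n} := by
  have h := expDecay_le_mean (ν := ν) (φ := s.indicator 1) (a := 0) (b := 1) (δ := δ)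
    (measurable_one.indicator hs).aemeasurable
    (ae_of_all _ fun a => ⟨Set.indicator_nonneg (fun _ _ => zero_le_one) a,
      Set.indicator_le_self' (fun _ _ => zero_le_one) a⟩) (by rwa [integral_indicator_one hs])
  simpa [Set.indicator_apply, div_eq_inv_mul] using h

end SampleLaw

section Bias

variable {E : Type*} [PseudoMetricSpace E] {n k : ℕ}

theorem exists_finset_measureReal_compl_biUnion_lt {α ι : Type*} [MeasurableSpace α] [Countable ι]
    (ν : Measure α) [IsFiniteMeasure ν] {A : ι → Set α} (hA : ∀ i, MeasurableSet (A i))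
    (hcover : ⋃ i, A i = Set.univ) {ε : ℝ} (hε : 0 < ε) :
    ∃ T : Finset ι, ν.real (⋃ i ∈ T, A i)ᶜ < ε := by
  have hlim := tendsto_measure_iInter_atTop (μ := ν) (s := fun T : Finset ι => (⋃ i ∈ T, A i)ᶜ)
    (fun T => (T.measurableSet_biUnion fun i _ => hA i).compl.nullMeasurableSet)
    (fun _ _ hST => Set.compl_subset_compl.2 (Set.biUnion_subset_biUnion_left hST))
    ⟨∅, measure_ne_top _ _⟩
  rw [← Set.compl_iUnion, ← Set.iUnion_eq_iUnion_finset, hcover, Set.compl_univ,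
    measure_empty] at hlim
  exact (((ENNReal.tendsto_toReal ENNReal.zero_ne_top).comp hlim).eventually_lt_const hε).exists

theorem exists_finset_oscillation_le [SecondCountableTopology E] [MeasurableSpace E]
    [OpensMeasurableSpace E] (ν : Measure E) [IsFiniteMeasure ν] {g : E → ℝ} (hg : Continuous g)
    {ε τ : ℝ} (hε : 0 < ε) (hτ : 0 < τ) :
    ∃ (T : Finset E) (ρ : E → ℝ),
      (∀ c, ∀ a ∈ Metric.ball c (3 * ρ c), ∀ b ∈ Metric.ball c (3 * ρ c), |g a - g b| ≤ τ) ∧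
      ν.real (⋃ c ∈ T, Metric.ball c (ρ c))ᶜ < ε := by
  have hosc (c : E) : ∃ ρ > 0, ∀ a ∈ Metric.ball c (3 * ρ), |g a - g c| < τ / 2 := by
    obtain ⟨δ, hδ, h⟩ := Metric.continuousAt_iff.1 (hg.continuousAt (x := c)) (τ / 2) (half_pos hτ)
    exact ⟨δ / 3, by positivity, fun a ha => h (by simpa [mul_div_cancel₀] using ha)⟩
  choose ρ hρ hosc using hosc
  obtain ⟨C, hC, hcover⟩ :=
    TopologicalSpace.countable_cover_nhds fun c => Metric.ball_mem_nhds c (hρ c)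
  have : Countable C := hC.to_subtype
  obtain ⟨T, hT⟩ := exists_finset_measureReal_compl_biUnion_lt ν
    (A := fun c : C => Metric.ball (c : E) (ρ c)) (fun _ => Metric.isOpen_ball.measurableSet)
    ((Set.biUnion_eq_iUnion C fun c _ => Metric.ball c (ρ c)).symm.trans hcover) hε
  refine ⟨T.map (Function.Embedding.subtype _), ρ, fun c a ha b hb => ?_, by simpa using hT⟩
  linarith [abs_sub_le (g a) (g c) (g b), hosc c a ha, abs_sub_comm (g b) (g c), hosc c b hb]

theorem exists_card_le_mul_forall_notMem {ι α : Type*} (T : Finset ι)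
    (A : ι → Set α) (k : ℕ) (x : Fin n → α) :
    ∃ B : Finset (Fin n), #B ≤ #T * k ∧
      ∀ i ∉ B, ∀ c ∈ T, x i ∈ A c → ∃ s : Finset (Fin n), k ≤ #s ∧ ∀ j ∈ s, x j ∈ A c := by
  classical
  let pts (c : ι) : Finset (Fin n) := {j | x j ∈ A c}
  -- The sets `A c` with fewer than `k` points of the sample contribute all their points to `B`.
  refine ⟨{c ∈ T | #(pts c) < k}.biUnion pts, ?_, fun i hi c hc hic => ⟨pts c, ?_, by simp [pts]⟩⟩
  · refine (Finset.card_biUnion_le_card_mul _ _ k fun c hc =>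
      (Finset.mem_filter.1 hc).2.le).trans ?_
    gcongr
    exact Finset.filter_subset _ _
  · by_contra! hlt
    exact hi (Finset.mem_biUnion.2 ⟨c, Finset.mem_filter.2 ⟨hc, hlt⟩, by simpa [pts] using hic⟩)

theorem mem_ball_of_mem_neighbors {x : Fin n → E} {c z : E} {ρ : ℝ} {s : Finset (Fin n)}
    (hs : k ≤ #s) (hball : ∀ i ∈ s, x i ∈ Metric.ball c ρ) (hz : z ∈ Metric.ball c ρ) {j : Fin n}
    (hj : j ∈ neighbors k x z) : x j ∈ Metric.ball c (3 * ρ) := by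
  obtain ⟨i, hi, hle⟩ := exists_dist_le_of_mem_neighbors hs hj
  have hi := Metric.mem_ball.1 (hball i hi)
  have hz := Metric.mem_ball.1 hz
  rw [Metric.mem_ball]
  linarith [dist_triangle (x j) z c, dist_triangle_right (x i) z c]

open Classical in
theorem meanSq_residual_comp_le_of_oscillation_le {g : E → ℝ} {M τ : ℝ} (hM : ∀ z, |g z| ≤ M)
    {T : Finset E} {ρ : E → ℝ}
    (hosc : ∀ c, ∀ a ∈ Metric.ball c (3 * ρ c), ∀ b ∈ Metric.ball c (3 * ρ c), |g a - g b| ≤ τ)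
    (hk : 0 < k) (hkn : k ≤ n) (x : Fin n → E) :
    meanSq (residual k x (g ∘ x)) ≤ τ ^ 2 + (2 * M) ^ 2 *
      (#{i | x i ∈ (⋃ c ∈ T, Metric.ball c (ρ c))ᶜ} / n + #T * (k / n)) := by
  obtain ⟨B, hBcard, hB⟩ :=
    exists_card_le_mul_forall_notMem T (fun c => Metric.ball c (ρ c)) k x
  let U : Finset (Fin n) := {i | x i ∈ (⋃ c ∈ T, Metric.ball c (ρ c))ᶜ}
  refine (meanSq_residual_comp_le hk hkn hM (B := U ∪ B) (τ := τ) fun i hi j hj => ?_).trans ?_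
  · simp only [U, Finset.mem_union, Finset.mem_filter_univ, Set.mem_compl_iff, not_or, not_not,
      Set.mem_iUnion] at hi
    obtain ⟨⟨c, hc, hic⟩, hiB⟩ := hi
    obtain ⟨s, hs, hball⟩ := hB i hiB c hc hic
    refine hosc c _ ?_ _ (mem_ball_of_mem_neighbors hs hball hic hj)
    rw [Metric.mem_ball] at hic ⊢
    linarith [dist_nonneg (x := x i) (y := c)]
  · have hcard : (#(U ∪ B) : ℝ) ≤ #U + #T * k := by
      exact_mod_cast (Finset.card_union_le U B).trans (by gcongr)
    gcongr
    calc (#(U ∪ B) / n : ℝ) ≤ (#U + #T * k) / n := by gcongr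
      _ = #U / n + #T * (k / n) := by ring

variable [SecondCountableTopology E] [MeasurableSpace E]

theorem expDecay_le_meanSq_residual_of_continuous [OpensMeasurableSpace E] (ν : Measure E)
    [IsProbabilityMeasure ν] {g : E → ℝ} (hg : Continuous g) {M : ℝ} (hM : ∀ z, |g z| ≤ M)
    {k : ℕ → ℕ} (hk : ∀ᶠ n in atTop, 0 < k n)
    (hkn : Tendsto (fun n => (k n : ℝ) / n) atTop (𝓝 0)) {ε : ℝ} (hε : 0 < ε) :
    ExpDecay id fun n =>
      (sampleLaw ν n).real {x | ε ≤ meanSq (residual (k n) x (g ∘ x))} := by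
  classical
  obtain ⟨η, hη, hη'⟩ : ∃ η > 0, (2 * M) ^ 2 * (η + η) < ε / 2 := by
    refine ⟨ε / (4 * ((2 * M) ^ 2 + 1)), by positivity, ?_⟩
    rw [← add_div, mul_div_assoc', div_lt_div_iff₀ (by positivity) two_pos]
    nlinarith [sq_nonneg (2 * M)]
  obtain ⟨T, ρ, hosc, hT⟩ := exists_finset_oscillation_le ν hg hη (Real.sqrt_pos.2 (half_pos hε))
  have hU : MeasurableSet (⋃ c ∈ T, Metric.ball c (ρ c))ᶜ :=
    (T.measurableSet_biUnion fun _ _ => Metric.isOpen_ball.measurableSet).compl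
  have hTk : ∀ᶠ n : ℕ in atTop, #T * ((k n : ℝ) / n) ≤ η := by
    have := hkn.const_mul (#T : ℝ)
    rw [mul_zero] at this
    exact this.eventually_le_const hη
  refine (expDecay_le_card_div hU hT).measureReal_mono_ae ?_
  filter_upwards [hk, hTk, hkn.eventually_le_const one_pos, eventually_gt_atTop 0]
    with n hk hTk hkn hn
  refine ae_of_all _ fun x hx => ?_
  rw [div_le_one (by exact_mod_cast hn), Nat.cast_le] at hkn
  by_contra! hlt
  have hle := meanSq_residual_comp_le_of_oscillation_le (T := T) hM hosc hk hkn x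
  rw [Real.sq_sqrt (half_pos hε).le] at hle
  have : (2 * M) ^ 2 * (#{i | x i ∈ (⋃ c ∈ T, Metric.ball c (ρ c))ᶜ} / n + #T * (k n / n : ℝ)) ≤
      (2 * M) ^ 2 * (η + η) := by
    gcongr
  linarith

end Bias

section GeneralBias

theorem ae_sampleLaw_injective {α : Type*} [MeasurableSpace α] [MeasurableEq α] (ν : Measure α)
    [IsProbabilityMeasure ν] [NullSingletonClass ν] (n : ℕ) :
    ∀ᵐ x ∂sampleLaw ν n, Function.Injective x := by
  have hne (i j : Fin n) (hij : i ≠ j) : ∀ᵐ x ∂sampleLaw ν n, x i ≠ x j := by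
    have hprod : (sampleLaw ν n).map (fun x => (x i, x j)) = ν.prod ν := by
      have hindep := (iIndepFun_pi (μ := fun _ : Fin n => ν) (X := fun _ => id)
        fun _ => aemeasurable_id).indepFun hij
      refine (hindep.map_prod_eq_prod_map_map (measurable_pi_apply i).aemeasurable
        (measurable_pi_apply j).aemeasurable).trans ?_
      exact congrArg₂ _ (measurePreserving_eval (fun _ : Fin n => ν) i).map_eq
        (measurePreserving_eval (fun _ : Fin n => ν) j).map_eq
    have hdiag : ν.prod ν (Set.diagonal α) = 0 := by
      rw [Measure.measure_prod_null measurableSet_diagonal]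
      refine ae_of_all _ fun a => ?_
      simp [Set.preimage]
    rw [← hprod] at hdiag
    exact ae_of_ae_map (p := fun q : α × α => q.1 ≠ q.2) (by fun_prop)
      (measure_eq_zero_iff_ae_notMem.1 hdiag)
  refine (ae_all_iff.2 fun i => ae_all_iff.2 fun j => ae_all_iff.2 (hne i j)).mono ?_
  exact fun x hx i j => not_imp_not.1 (hx i j)

theorem exists_continuous_integral_sq_sub_lt {α : Type*} [TopologicalSpace α] [NormalSpace α]
    [MeasurableSpace α] [BorelSpace α] {ν : Measure α} [IsFiniteMeasure ν] [ν.WeaklyRegular]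
    {h : α → ℝ} (hh : AEMeasurable h ν) {M : ℝ} (hM : ∀ᵐ z ∂ν, |h z| ≤ M) {δ : ℝ} (hδ : 0 < δ) :
    ∃ g : α → ℝ, Continuous g ∧ (∃ L, ∀ z, |g z| ≤ L) ∧ ∫ z, (h z - g z) ^ 2 ∂ν < δ := by
  obtain ⟨g, hg, -⟩ := (MemLp.of_bound (p := ENNReal.ofReal 2) hh.aestronglyMeasurable M
    hM).exists_boundedContinuous_integral_rpow_sub_le two_pos (half_pos hδ)
  refine ⟨g, g.continuous, ⟨‖g‖, g.norm_coe_le_norm⟩, lt_of_le_of_lt ?_ (half_lt_self hδ)⟩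
  simpa using hg

theorem expDecay_le_meanSq_residual {E : Type*} [MetricSpace E] [SecondCountableTopology E]
    [MeasurableSpace E] [BorelSpace E] {γ : ℕ} (hγ : IsStoneBound E γ) {ν : Measure E}
    [IsProbabilityMeasure ν] [NullSingletonClass ν] {h : E → ℝ} (hh : AEMeasurable h ν) {M : ℝ}
    (hM : ∀ᵐ z ∂ν, |h z| ≤ M) {k : ℕ → ℕ} (hk : ∀ᶠ n in atTop, 0 < k n)
    (hkn : Tendsto (fun n => (k n : ℝ) / n) atTop (𝓝 0)) {ε : ℝ} (hε : 0 < ε) :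
    ExpDecay id fun n =>
      (sampleLaw ν n).real {x | ε ≤ meanSq (residual (k n) x (h ∘ x))} := by
  obtain ⟨g, hg, ⟨L, hL⟩, hgh⟩ :=
    exists_continuous_integral_sq_sub_lt hh hM (δ := ε / (8 * (1 + γ))) (by positivity)
  have hdiff : ∀ᵐ z ∂ν, |(h - g) z| ≤ M + L := by
    filter_upwards [hM] with z hz using (abs_sub _ _).trans (add_le_add hz (hL z))
  have hbias := expDecay_le_meanSq_residual_of_continuous ν hg hL hk hkn
    (ε := ε / 4) (by positivity)
  have happrox := expDecay_le_meanSq (hh.sub hg.aemeasurable) hdiff hgh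
  refine (hbias.measureReal_union happrox).measureReal_mono_ae (.of_forall fun n => ?_)
  filter_upwards [ae_sampleLaw_injective ν n] with x hx hε'
  by_contra! hlt
  simp only [Set.mem_union, Set.mem_ofPred_eq, not_or, not_le] at hlt hε'
  have hstone : _ ≤ _ + 4 * (1 + γ) * meanSq ((h - g) ∘ x) :=
    meanSq_residual_le (k := k n) hγ hx (h ∘ x) (g ∘ x)
  have hlt₂ : 4 * (1 + γ) * meanSq ((h - g) ∘ x) < ε / 2 := by
    have := (lt_div_iff₀ (by positivity)).1 hlt.2
    linarith
  linarith [hlt.1]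

end GeneralBias

section PiKernel

variable {E F : Type*} [MeasurableSpace E] [MeasurableSpace F]

/-- The product kernel `x ↦ ⨂ᵢ κ (xᵢ)`: the law of independent labels of the inputs `x`, when
`κ` is the conditional law of a label given its input. -/
noncomputable def piKernel (κ : Kernel E F) [IsMarkovKernel κ] (n : ℕ) :
    Kernel (Fin n → E) (Fin n → F) where
  toFun x := Measure.pi fun i => κ (x i)
  measurable' := by
    refine Measurable.measure_of_isPiSystem_of_isProbabilityMeasure generateFrom_pi.symm
      isPiSystem_pi ?_
    rintro _ ⟨s, hs, rfl⟩
    simp only [Measure.pi_pi]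
    exact Finset.measurable_prod _ fun i _ =>
      (κ.measurable_coe (hs i (Set.mem_univ i))).comp (measurable_pi_apply i)

variable (ν : Measure E) [IsProbabilityMeasure ν] (κ : Kernel E F) [IsMarkovKernel κ] {n : ℕ}

instance : IsMarkovKernel (piKernel κ n) :=
  ⟨fun x => inferInstanceAs (IsProbabilityMeasure (Measure.pi fun i => κ (x i)))⟩

theorem lintegral_sampleLaw_prod_eq {f : Fin n → E → ENNReal} (hf : ∀ i, Measurable (f i)) :
    ∫⁻ x, ∏ i, f i (x i) ∂sampleLaw ν n = ∏ i, ∫⁻ a, f i a ∂ν := by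
  refine (lintegral_prod_eq_prod_lintegral_of_indepFun Finset.univ
    (fun i (x : Fin n → E) => f i (x i)) (iIndepFun_pi fun i => (hf i).aemeasurable)
    fun i => (hf i).comp (measurable_pi_apply i)).trans ?_
  exact Finset.prod_congr rfl fun i _ =>
    (measurePreserving_eval (fun _ : Fin n => ν) i).lintegral_comp (hf i)

theorem sampleLaw_compProd :
    sampleLaw (ν ⊗ₘ κ) n =
      (sampleLaw ν n ⊗ₘ piKernel κ n).map fun p i => (p.1 i, p.2 i) := by
  have hzip : Measurable fun (p : (Fin n → E) × (Fin n → F)) i => (p.1 i, p.2 i) := by fun_prop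
  refine Measure.pi_eq fun s hs => ?_
  rw [Measure.map_apply hzip (.univ_pi hs), Measure.compProd_apply (hzip (.univ_pi hs))]
  have hsection (x : Fin n → E) : piKernel κ n x (Prod.mk x ⁻¹'
      ((fun p : (Fin n → E) × (Fin n → F) => fun i => (p.1 i, p.2 i)) ⁻¹' Set.univ.pi s)) =
      ∏ i, κ (x i) (Prod.mk (x i) ⁻¹' s i) :=
    Measure.pi_pi (fun i => κ (x i)) fun i => Prod.mk (x i) ⁻¹' s i
  simp only [hsection, Measure.compProd_apply (hs _)]
  exact lintegral_sampleLaw_prod_eq ν fun i => Kernel.measurable_kernel_prodMk_left (hs i)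

variable {ν κ}

theorem measureReal_sampleLaw_compProd_le {S : Set (Fin n → E × F)} (hS : MeasurableSet S) {b : ℝ}
    (hb : 0 ≤ b) (h : ∀ᵐ x ∂sampleLaw ν n,
      (Measure.pi fun i => κ (x i)).real {y | (fun i => (x i, y i)) ∈ S} ≤ b) :
    (sampleLaw (ν ⊗ₘ κ) n).real S ≤ b := by
  have hzip : Measurable fun (p : (Fin n → E) × (Fin n → F)) i => (p.1 i, p.2 i) := by fun_prop
  refine ENNReal.toReal_le_of_le_ofReal hb ?_
  rw [sampleLaw_compProd, Measure.map_apply hzip hS, Measure.compProd_apply (hzip hS)]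
  calc _ ≤ ∫⁻ _, ENNReal.ofReal b ∂sampleLaw ν n := lintegral_mono_ae <| h.mono fun x hx =>
        (ENNReal.le_ofReal_iff_toReal_le (measure_ne_top _ _) hb).2 hx
    _ = ENNReal.ofReal b := by simp

end PiKernel

section Noise

theorem measureReal_pi_le_abs_sum_le {ι : Type*} [Fintype ι] {F : Type*} [MeasurableSpace F]
    {μ : ι → Measure F} [∀ i, IsProbabilityMeasure (μ i)] {ξ : ι → F → ℝ} {c : NNReal}
    (hξ : ∀ i, HasSubgaussianMGF (ξ i) c (μ i)) (s : Finset ι) {ε : ℝ} (hε : 0 ≤ ε) :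
    (Measure.pi μ).real {y | ε ≤ |∑ i ∈ s, ξ i (y i)|} ≤
      2 * Real.exp (-ε ^ 2 / (2 * (#s * c))) := by
  have hsub : HasSubgaussianMGF (fun y => ∑ i ∈ s, ξ i (y i)) (∑ _i ∈ s, c) (Measure.pi μ) := by
    refine HasSubgaussianMGF.sum_of_iIndepFun (iIndepFun_pi fun i => (hξ i).aemeasurable)
      fun i _ => ?_
    have heval := measurePreserving_eval μ i
    exact HasSubgaussianMGF.of_map heval.measurable.aemeasurable (heval.map_eq.symm ▸ hξ i)
  have hc : ((∑ _i ∈ s, c : NNReal) : ℝ) = #s * c := by simp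
  rw [two_mul, ← hc]
  refine (measureReal_mono fun y hy => ?_).trans ((measureReal_union_le _ _).trans
    (add_le_add (hsub.measure_ge_le hε) (hsub.neg.measure_ge_le hε)))
  exact le_abs.1 (Set.mem_ofPred_eq ▸ hy)

variable {E : Type*} [PseudoMetricSpace E] {n k : ℕ}

theorem measureReal_pi_le_abs_knnEstimate_le {μ : Fin n → Measure ℝ}
    [∀ i, IsProbabilityMeasure (μ i)] {a : Fin n → ℝ} {c : NNReal}
    (hμ : ∀ i, HasSubgaussianMGF (fun y => y - a i) c (μ i)) (hk : 0 < k) (hkn : k ≤ n)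
    (x : Fin n → E) (z : E) {t : ℝ} (ht : 0 ≤ t) :
    (Measure.pi μ).real {y | t ≤ |knnEstimate k x (y - a) z|} ≤
      2 * Real.exp (-(t ^ 2 / (2 * c) * k)) := by
  have hk' : (0 : ℝ) < k := by exact_mod_cast hk
  have hevent : {y : Fin n → ℝ | t ≤ |knnEstimate k x (y - a) z|} =
      {y | k * t ≤ |∑ i ∈ neighbors k x z, (y i - a i)|} := by
    ext y
    simp only [Set.mem_ofPred_eq, knnEstimate, Pi.sub_apply, one_div_mul_eq_div, abs_div,
      Nat.abs_cast, le_div_iff₀' hk']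
  rw [hevent]
  refine (measureReal_pi_le_abs_sum_le hμ _ (by positivity)).trans_eq ?_
  rw [card_neighbors hkn]
  field_simp

variable [SecondCountableTopology E] [MeasurableSpace E] [OpensMeasurableSpace E]

theorem measurableSet_mem_neighbors (k : ℕ) (i j : Fin n) :
    MeasurableSet {x : Fin n → E | j ∈ neighbors k x (x i)} := by
  classical
  have hdist (l : Fin n) : Measurable fun x : Fin n → E => dist (x l) (x i) := by fun_prop
  have hcloser (l : Fin n) : MeasurableSet {x : Fin n → E | Closer x (x i) l j} :=
    (measurableSet_lt (hdist l) (hdist j)).union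
      ((measurableSet_eq_fun (hdist l) (hdist j)).inter (MeasurableSet.const _))
  simp only [mem_neighbors, Finset.card_filter]
  exact measurableSet_lt (Finset.measurable_fun_sum _ fun l _ =>
    Measurable.ite (hcloser l) measurable_const measurable_const) measurable_const

theorem measurable_smooth_apply (k : ℕ) (i : Fin n) :
    Measurable fun p : (Fin n → E) × (Fin n → ℝ) => smooth k p.1 p.2 i := by
  classical
  have hsum (p : (Fin n → E) × (Fin n → ℝ)) : smooth k p.1 p.2 i =
      (1 / (k : ℝ)) * ∑ j, if j ∈ neighbors k p.1 (p.1 i) then p.2 j else 0 := by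
    rw [Finset.sum_ite_mem, Finset.univ_inter, smooth, knnEstimate]
  simp only [hsum]
  refine (Finset.measurable_fun_sum _ fun j _ => ?_).const_mul _
  exact Measurable.ite (measurable_fst (measurableSet_mem_neighbors k i j)) (by fun_prop)
    measurable_const

variable {ν : Measure E} [IsProbabilityMeasure ν] {κ : Kernel E ℝ} [IsMarkovKernel κ] {h : E → ℝ}
  {c : NNReal}

theorem measureReal_exists_le_abs_smooth_le (hh : Measurable h)
    (hκ : ∀ᵐ a ∂ν, HasSubgaussianMGF (fun y => y - h a) c (κ a)) (hk : 0 < k) (hkn : k ≤ n)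
    {t : ℝ} (ht : 0 ≤ t) :
    (sampleLaw (ν ⊗ₘ κ) n).real
        {z | ∃ i, t ≤ |smooth k (Prod.fst ∘ z) (Prod.snd ∘ z - h ∘ Prod.fst ∘ z) i|} ≤
      n * (2 * Real.exp (-(t ^ 2 / (2 * c) * k))) := by
  rw [Set.ofPred_exists]
  suffices ∀ i, (sampleLaw (ν ⊗ₘ κ) n).real
      {z | t ≤ |smooth k (Prod.fst ∘ z) (Prod.snd ∘ z - h ∘ Prod.fst ∘ z) i|} ≤
        2 * Real.exp (-(t ^ 2 / (2 * c) * k)) from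
    (measureReal_iUnion_fintype_le _).trans
      ((Finset.sum_le_card_nsmul _ _ _ fun i _ => this i).trans_eq (by simp))
  intro i
  refine measureReal_sampleLaw_compProd_le ?_ (by positivity) ?_
  · have hpair : Measurable fun z : Fin n → E × ℝ =>
        (Prod.fst ∘ z, Prod.snd ∘ z - h ∘ Prod.fst ∘ z) :=
      Measurable.prodMk (measurable_pi_lambda _ fun i => by fun_prop)
        (measurable_pi_lambda _ fun i => Measurable.sub (by fun_prop)
          (hh.comp (measurable_fst.comp (measurable_pi_apply i))))
    have hmeas := (measurable_smooth_apply k i).comp hpair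
    exact measurableSet_le measurable_const hmeas.abs
  · filter_upwards [ae_sampleLaw_forall hκ] with x hx
    exact measureReal_pi_le_abs_knnEstimate_le hx hk hkn x (x i) ht

theorem tendsto_atTop_of_log_isLittleO {k : ℕ → ℕ}
    (hlog : (fun n : ℕ => Real.log n) =o[atTop] fun n => (k n : ℝ)) : Tendsto k atTop atTop := by
  refine tendsto_natCast_atTop_iff.1
    (tendsto_atTop_mono' _ ?_ (Real.tendsto_log_atTop.comp tendsto_natCast_atTop_atTop))
  filter_upwards [hlog.bound one_pos] with n hn
  simpa using (le_abs_self _).trans hn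

theorem expDecay_exists_le_abs_smooth (hc : 0 < c) (hh : Measurable h)
    (hκ : ∀ᵐ a ∂ν, HasSubgaussianMGF (fun y => y - h a) c (κ a)) {k : ℕ → ℕ}
    (hkn : ∀ᶠ n in atTop, k n ≤ n)
    (hlog : (fun n : ℕ => Real.log n) =o[atTop] fun n => (k n : ℝ)) {t : ℝ} (ht : 0 < t) :
    ExpDecay k fun n => (sampleLaw (ν ⊗ₘ κ) n).real
      {z | ∃ i, t ≤ |smooth (k n) (Prod.fst ∘ z) (Prod.snd ∘ z - h ∘ Prod.fst ∘ z) i|} := by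
  have hdecay : ExpDecay k fun n => 2 * Real.exp (-(t ^ 2 / (2 * c) * k n)) :=
    ⟨_, by positivity, 2, two_pos, .of_forall fun n => le_rfl⟩
  refine (hdecay.natCast_mul hlog).mono ?_
  filter_upwards [hkn, (tendsto_atTop_of_log_isLittleO hlog).eventually_gt_atTop 0]
    with n hkn hk using measureReal_exists_le_abs_smooth_le hh hκ hk hkn ht.le

end Noise

section ConditionalLaw

variable {E : Type*} [MeasurableSpace E]

theorem condExp_snd_compProd_ae_eq {ν : Measure E} [IsProbabilityMeasure ν] {κ : Kernel E ℝ}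
    [IsMarkovKernel κ] (hint : Integrable Prod.snd (ν ⊗ₘ κ)) :
    (ν ⊗ₘ κ)[Prod.snd | MeasurableSpace.comap Prod.fst inferInstance] =ᵐ[ν ⊗ₘ κ]
      fun z => ∫ y, y ∂κ z.1 := by
  have hfst : (ν ⊗ₘ κ).map Prod.fst = ν := Measure.fst_compProd ν κ
  have hcond : condDistrib Prod.snd Prod.fst (ν ⊗ₘ κ) =ᵐ[(ν ⊗ₘ κ).map Prod.fst] κ :=
    condDistrib_ae_eq_of_measure_eq_compProd _ measurable_snd.aemeasurable
      (by rw [hfst]; exact Measure.map_id)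
  filter_upwards [condExp_ae_eq_integral_condDistrib' measurable_fst hint,
    ae_of_ae_map measurable_fst.aemeasurable hcond] with z hz hκ
  rw [hz, hκ]

theorem isRegressionFunction_compProd_iff {ν : Measure E} [IsProbabilityMeasure ν]
    {κ : Kernel E ℝ} [IsMarkovKernel κ] {h : E → ℝ} (hint : Integrable Prod.snd (ν ⊗ₘ κ)) :
    IsRegressionFunction (ν ⊗ₘ κ) h ↔ Measurable h ∧ ∀ᵐ a ∂ν, ∫ y, y ∂κ a = h a := by
  refine and_congr_right fun hh => ?_
  have hκ : Measurable fun a => ∫ y, y ∂κ a :=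
    (stronglyMeasurable_id.integral_kernel (κ := κ)).measurable
  have hce := condExp_snd_compProd_ae_eq hint
  calc _ ↔ (fun z : E × ℝ => ∫ y, y ∂κ z.1) =ᵐ[ν ⊗ₘ κ] fun z => h z.1 :=
        ⟨fun hreg => hce.symm.trans hreg, fun hκh => hce.trans hκh⟩
    _ ↔ ∀ᵐ a ∂(ν ⊗ₘ κ).fst, ∫ y, y ∂κ a = h a :=
        (ae_map_iff measurable_fst.aemeasurable (measurableSet_eq_fun hκ hh)).symm
    _ ↔ ∀ᵐ a ∂ν, ∫ y, y ∂κ a = h a := by rw [Measure.fst_compProd]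

end ConditionalLaw

section Resampling

variable {E : Type*} [MeasurableSpace E]

instance : IsProbabilityMeasure uniformPM :=
  cond_isProbabilityMeasure_of_finite (by simp) (by simp)

instance (m : ℕ) : IsProbabilityMeasure (uniformPerm m) :=
  PMF.toMeasure.isProbabilityMeasure _

theorem measurable_sgn : Measurable sgn :=
  Measurable.ite measurableSet_Ici measurable_const measurable_const

theorem sgn_mem_Icc (t : ℝ) : sgn t ∈ Set.Icc (-1 : ℝ) 1 := by
  unfold sgn; split_ifs <;> simp

theorem uniformPM_real_Ici_neg {a : ℝ} (ha : a ∈ Set.Icc (-1 : ℝ) 1) :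
    uniformPM.real (Set.Ici (-a)) = (1 + a) / 2 := by
  have hinter : Set.Icc (-1 : ℝ) 1 ∩ Set.Ici (-a) = Set.Icc (-a) 1 := by
    rw [← Set.Ici_inter_Iic, Set.inter_right_comm, Set.Ici_inter_Ici, Set.Ici_inter_Iic,
      max_eq_right (neg_le_neg ha.2)]
  rw [uniformPM, measureReal_def, cond_apply measurableSet_Icc, hinter, ENNReal.toReal_mul]
  simp only [Real.volume_Icc, ENNReal.toReal_inv]
  rw [ENNReal.toReal_ofReal (by norm_num), ENNReal.toReal_ofReal (by linarith [ha.1])]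
  ring

theorem integral_sgn_add_uniformPM {a : ℝ} (ha : a ∈ Set.Icc (-1 : ℝ) 1) :
    ∫ u, sgn (a + u) ∂uniformPM = a := by
  have hsgn (u : ℝ) : sgn (a + u) = 2 * (Set.Ici (-a)).indicator 1 u - 1 := by
    simp only [sgn, Set.indicator_apply, Set.mem_Ici, neg_le_iff_add_nonneg', Pi.one_apply]
    split_ifs <;> norm_num
  simp only [hsgn]
  rw [integral_sub, integral_const_mul, integral_indicator_one measurableSet_Ici,
    uniformPM_real_Ici_neg ha]
  · rw [integral_const, probReal_univ, one_smul]; ring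
  · exact ((integrable_const 1).indicator measurableSet_Ici).const_mul 2
  · exact integrable_const 1

theorem map_prod_eq_compProd {F G : Type*} [MeasurableSpace F] [MeasurableSpace G]
    (ν : Measure E) [SFinite ν] (ρ : Measure F) [SFinite ρ] {φ : E × F → G}
    (hφ : Measurable φ) :
    (ν.prod ρ).map (fun p => (p.1, φ p)) = ν ⊗ₘ (Kernel.id ×ₖ Kernel.const E ρ).map φ := by
  ext s hs
  have hpair : Measurable fun p : E × F => (p.1, φ p) := measurable_fst.prodMk hφ
  rw [Measure.map_apply hpair hs, Measure.prod_apply (hpair hs), Measure.compProd_apply hs]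
  refine lintegral_congr fun a => ?_
  rw [Kernel.map_apply' _ hφ _ (measurable_prodMk_left hs),
    Kernel.id_prod_apply' _ _ (hφ (measurable_prodMk_left hs)), Kernel.const_apply]
  rfl

/-- The law of an input together with its resampled label `sign (g x + u)`, when inputs have the
law `ν` and `g` is the candidate regression function. -/
noncomputable def resampledLaw (ν : Measure E) (g : E → ℝ) : Measure (E × ℝ) :=
  (ν.prod uniformPM).map fun p => (p.1, sgn (g p.1 + p.2))

variable {ν : Measure E} {g : E → ℝ}

theorem measurable_sgn_add (hg : Measurable g) : Measurable fun p : E × ℝ => sgn (g p.1 + p.2) :=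
  measurable_sgn.comp (by fun_prop)

theorem isProbabilityMeasure_resampledLaw [IsProbabilityMeasure ν] (hg : Measurable g) :
    IsProbabilityMeasure (resampledLaw ν g) :=
  Measure.isProbabilityMeasure_map (measurable_fst.prodMk (measurable_sgn_add hg)).aemeasurable

theorem fst_resampledLaw (hg : Measurable g) : (resampledLaw ν g).fst = ν :=
  (Measure.fst_map_prodMk (measurable_sgn_add hg)).trans Measure.fst_prod

theorem ae_snd_mem_Icc_resampledLaw (hg : Measurable g) :
    ∀ᵐ z ∂resampledLaw ν g, z.2 ∈ Set.Icc (-1 : ℝ) 1 := by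
  rw [resampledLaw, ae_map_iff (measurable_fst.prodMk (measurable_sgn_add hg)).aemeasurable
    (measurable_snd measurableSet_Icc)]
  exact ae_of_all _ fun p => sgn_mem_Icc _

theorem isRegressionFunction_resampledLaw [IsProbabilityMeasure ν] (hg : Measurable g)
    (hg1 : ∀ᵐ a ∂ν, g a ∈ Set.Icc (-1 : ℝ) 1) :
    IsRegressionFunction (resampledLaw ν g) g := by
  have hsgn := measurable_sgn_add hg
  have hprob := isProbabilityMeasure_resampledLaw (ν := ν) hg
  have hint : Integrable Prod.snd (resampledLaw ν g) :=
    .of_mem_Icc (-1) 1 measurable_snd.aemeasurable (ae_snd_mem_Icc_resampledLaw hg)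
  have := Kernel.IsMarkovKernel.map (Kernel.id ×ₖ Kernel.const E uniformPM) hsgn
  rw [resampledLaw, map_prod_eq_compProd ν uniformPM hsgn] at hint ⊢
  refine (isRegressionFunction_compProd_iff hint).2 ⟨hg, ?_⟩
  filter_upwards [hg1] with a ha
  rw [Kernel.map_apply _ hsgn, integral_map hsgn.aemeasurable (by fun_prop),
    Kernel.prod_apply, Kernel.id_apply, Kernel.const_apply, Measure.dirac_prod,
    integral_map measurable_prodMk_left.aemeasurable hsgn.aestronglyMeasurable]
  exact integral_sgn_add_uniformPM ha

end Resampling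

section Risk

theorem measureReal_preimage_le {α β : Type*} [MeasurableSpace α] [MeasurableSpace β]
    {μ : Measure α} {ν : Measure β} [IsFiniteMeasure ν] {T : α → β}
    (hT : AEMeasurable T μ) (hmap : μ.map T = ν) (s : Set β) :
    μ.real (T ⁻¹' s) ≤ ν.real s := by
  subst hmap
  exact ENNReal.toReal_mono (measure_ne_top _ _) (Measure.le_map_apply hT s)

theorem measurePreserving_sampleLaw {α β : Type*} [MeasurableSpace α] [MeasurableSpace β]
    {μ : Measure α} {ν : Measure β} [SigmaFinite μ] [SigmaFinite ν] {T : α → β}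
    (hT : MeasurePreserving T μ ν) (n : ℕ) :
    MeasurePreserving (T ∘ ·) (sampleLaw μ n) (sampleLaw ν n) :=
  measurePreserving_pi _ _ fun _ => hT

theorem eventually_le_of_tendsto_div {k : ℕ → ℕ}
    (hkn : Tendsto (fun n => (k n : ℝ) / n) atTop (𝓝 0)) : ∀ᶠ n in atTop, k n ≤ n := by
  filter_upwards [hkn.eventually_le_const one_pos, eventually_gt_atTop 0] with n hn hpos
  exact_mod_cast (div_le_one (by exact_mod_cast hpos)).1 hn

theorem ae_hasSubgaussianMGF_condKernel {E : Type*} [MeasurableSpace E] {Q : Measure (E × ℝ)}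
    [IsProbabilityMeasure Q] {a b : ℝ} (hQ : ∀ᵐ z ∂Q, z.2 ∈ Set.Icc a b) {h : E → ℝ}
    (hreg : IsRegressionFunction Q h) :
    ∀ᵐ x ∂Q.fst, h x ∈ Set.Icc a b ∧
      HasSubgaussianMGF (fun y => y - h x) ((‖b - a‖₊ / 2) ^ 2) (Q.condKernel x) := by
  have hint : Integrable Prod.snd Q := .of_mem_Icc a b measurable_snd.aemeasurable hQ
  rw [← Q.disintegrate Q.condKernel] at hQ hint hreg
  filter_upwards [Measure.ae_ae_of_ae_compProd hQ,
    ((isRegressionFunction_compProd_iff hint).1 hreg).2] with x hx hmean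
  rw [← hmean]
  exact ⟨(convex_Icc a b).integral_mem isClosed_Icc hx (.of_mem_Icc a b aemeasurable_id hx),
    hasSubgaussianMGF_of_mem_Icc aemeasurable_id hx⟩

variable {E : Type*} [MetricSpace E] [SecondCountableTopology E] [MeasurableSpace E]
  [BorelSpace E] {γ : ℕ} {h : E → ℝ} {k : ℕ → ℕ}

theorem expDecay_le_meanSq_sub_smooth_compProd (hγ : IsStoneBound E γ) {ν : Measure E}
    [IsProbabilityMeasure ν] [NullSingletonClass ν] {κ : Kernel E ℝ} [IsMarkovKernel κ]
    (hh : Measurable h) {M : ℝ} (hM : ∀ᵐ x ∂ν, |h x| ≤ M) {c : NNReal} (hc : 0 < c)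
    (hκ : ∀ᵐ x ∂ν, HasSubgaussianMGF (fun y => y - h x) c (κ x))
    (hkn : Tendsto (fun n => (k n : ℝ) / n) atTop (𝓝 0))
    (hlog : (fun n : ℕ => Real.log n) =o[atTop] fun n => (k n : ℝ)) {ε : ℝ} (hε : 0 < ε) :
    ExpDecay k fun n => (sampleLaw (ν ⊗ₘ κ) n).real
      {z | ε ≤ meanSq (h ∘ Prod.fst ∘ z - smooth (k n) (Prod.fst ∘ z) (Prod.snd ∘ z))} := by
  have hle := eventually_le_of_tendsto_div hkn
  have hfst : MeasurePreserving Prod.fst (ν ⊗ₘ κ) ν :=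
    ⟨measurable_fst, Measure.fst_compProd ν κ⟩
  have hbias := ((expDecay_le_meanSq_residual hγ hh.aemeasurable hM
    ((tendsto_atTop_of_log_isLittleO hlog).eventually_gt_atTop 0) hkn
    (ε := ε / 4) (by positivity)).mono_rate hle).mono <| .of_forall fun n =>
      have hsample := measurePreserving_sampleLaw hfst n
      measureReal_preimage_le hsample.measurable.aemeasurable hsample.map_eq _
  have hnoise := expDecay_exists_le_abs_smooth hc hh hκ hle hlog (t := √(ε / 4)) (by positivity)
  refine (hbias.measureReal_union hnoise).measureReal_mono_ae
    (.of_forall fun n => ae_of_all _ fun z hz => ?_)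
  by_contra! hlt
  simp only [Set.mem_union, Set.mem_preimage, Set.mem_ofPred_eq, not_or, not_le, not_exists]
    at hlt hz
  have hnoise_le := meanSq_le_sq fun i => (hlt.2 i).le
  rw [Real.sq_sqrt (by positivity)] at hnoise_le
  linarith [meanSq_sub_smooth_le (k := k n) h (Prod.fst ∘ z) (Prod.snd ∘ z), hlt.1]

theorem expDecay_le_meanSq_sub_smooth (hγ : IsStoneBound E γ) {Q : Measure (E × ℝ)}
    [IsProbabilityMeasure Q] [NullSingletonClass Q.fst] {M : ℝ} (hQ : ∀ᵐ z ∂Q, |z.2| ≤ M)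
    (hreg : IsRegressionFunction Q h) (hkn : Tendsto (fun n => (k n : ℝ) / n) atTop (𝓝 0))
    (hlog : (fun n : ℕ => Real.log n) =o[atTop] fun n => (k n : ℝ)) {ε : ℝ} (hε : 0 < ε) :
    ExpDecay k fun n => (sampleLaw Q n).real
      {z | ε ≤ meanSq (h ∘ Prod.fst ∘ z - smooth (k n) (Prod.fst ∘ z) (Prod.snd ∘ z))} := by
  let L : ℝ := max M 1
  have hL : 0 < L := one_pos.trans_le (le_max_right _ _)
  have hcond := ae_hasSubgaussianMGF_condKernel (a := -L) (b := L)
    (hQ.mono fun z hz => abs_le.1 (hz.trans (le_max_left M 1))) hreg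
  have hc : 0 < (‖L - -L‖₊ / 2) ^ 2 :=
    pow_pos (half_pos (nnnorm_pos.2 (sub_ne_zero.2 (neg_lt_self hL).ne'))) 2
  simpa only [Q.disintegrate Q.condKernel] using expDecay_le_meanSq_sub_smooth_compProd hγ hreg.1
    (hcond.mono fun x hx => abs_le.2 hx.1) hc (hcond.mono fun x hx => hx.2) hkn hlog hε

end Risk

section Rank

variable {E : Type*} [PseudoMetricSpace E] {n m : ℕ} [NeZero m]

theorem refVar_zero (k : ℕ) (g : E → ℝ) (x : Fin n → E) (y : Fin n → ℝ)
    (u : Fin n → {j : Fin m // j ≠ 0} → ℝ) :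
    refVar k g x y u 0 = meanSq (g ∘ x - smooth k x y) := by
  have hlabels : labels g x y u 0 = y := funext fun i => dif_pos rfl
  rw [refVar, hlabels]; rfl

theorem refVar_of_ne_zero (k : ℕ) (g : E → ℝ) (x : Fin n → E) (y : Fin n → ℝ)
    (u : Fin n → {j : Fin m // j ≠ 0} → ℝ) (j : {j : Fin m // j ≠ 0}) :
    refVar k g x y u j = meanSq (g ∘ x - smooth k x fun i => sgn (g (x i) + u i j)) := by
  have hlabels : labels g x y u j = fun i => sgn (g (x i) + u i j) :=
    funext fun i => dif_neg j.2
  rw [refVar, hlabels]; rfl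

theorem rank_eq_of_forall_lt {k : ℕ} {g : E → ℝ} {x : Fin n → E} {y : Fin n → ℝ}
    {u : Fin n → {j : Fin m // j ≠ 0} → ℝ} (p : Equiv.Perm (Fin m))
    (h : ∀ j : {j : Fin m // j ≠ 0}, refVar k g x y u j < refVar k g x y u 0) :
    rank k g x y u p = m := by
  classical
  rw [rank, Finset.sum_congr rfl fun j hj =>
    if_pos (Or.inl (h ⟨j, (Finset.mem_filter_univ j).1 hj⟩)), Finset.sum_const,
    Finset.filter_ne' Finset.univ (0 : Fin m), Finset.card_erase_of_mem (Finset.mem_univ _),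
    Finset.card_univ, Fintype.card_fin, smul_eq_mul, mul_one,
    Nat.add_sub_cancel' (NeZero.one_le (n := m))]

end Rank

section Experiment

section MeasurePreserving

variable {E : Type*} [MeasurableSpace E] {Q : Measure (E × ℝ)} [IsProbabilityMeasure Q]
  {m : ℕ} [NeZero m]

instance (n : ℕ) : IsProbabilityMeasure (experimentLaw Q n m) := by
  unfold experimentLaw; infer_instance

theorem measurePreserving_resampledSample {g : E → ℝ} (hg : Measurable g) (n : ℕ)
    (j : {j : Fin m // j ≠ 0}) :
    MeasurePreserving (fun (w : (Fin n → E × ℝ) × (Fin n → {j : Fin m // j ≠ 0} → ℝ) ×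
        Equiv.Perm (Fin m)) (i : Fin n) => ((w.1 i).1, sgn (g (w.1 i).1 + w.2.1 i j)))
      (experimentLaw Q n m) (sampleLaw (resampledLaw Q.fst g) n) := by
  have := isProbabilityMeasure_resampledLaw (ν := Q.fst) hg
  have hdropPerm : MeasurePreserving (Prod.map id Prod.fst) (experimentLaw Q n m)
      ((sampleLaw Q n).prod (sampleLaw (Measure.pi fun _ => uniformPM) n)) :=
    (MeasurePreserving.id _).prod measurePreserving_fst
  have hzip := (measurePreserving_arrowProdEquivProdArrow (E × ℝ) ({j : Fin m // j ≠ 0} → ℝ)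
    (Fin n) (fun _ => Q) (fun _ => Measure.pi fun _ => uniformPM)).symm
  have hinputs : MeasurePreserving (Prod.map Prod.fst fun u => u j)
      (Q.prod (Measure.pi fun _ : {j : Fin m // j ≠ 0} => uniformPM)) (Q.fst.prod uniformPM) :=
    MeasurePreserving.prod ⟨measurable_fst, rfl⟩ (measurePreserving_eval _ j)
  have hlabel : MeasurePreserving (fun p : E × ℝ => (p.1, sgn (g p.1 + p.2)))
      (Q.fst.prod uniformPM) (resampledLaw Q.fst g) :=
    ⟨measurable_fst.prodMk (measurable_sgn_add hg), rfl⟩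
  exact (measurePreserving_sampleLaw (hlabel.comp hinputs) n).comp (hzip.comp hdropPerm)

end MeasurePreserving

variable {E : Type*} [MetricSpace E] [SecondCountableTopology E] [MeasurableSpace E]
  [BorelSpace E] {γ : ℕ} {Q : Measure (E × ℝ)} [IsProbabilityMeasure Q]
  [NullSingletonClass Q.fst] {m : ℕ} [NeZero m] {k : ℕ → ℕ} {g r : E → ℝ}

theorem expDecay_le_refVar_of_ne_zero (hγ : IsStoneBound E γ) (hg : Measurable g)
    (hg1 : ∀ᵐ x ∂Q.fst, g x ∈ Set.Icc (-1 : ℝ) 1)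
    (hkn : Tendsto (fun n => (k n : ℝ) / n) atTop (𝓝 0))
    (hlog : (fun n : ℕ => Real.log n) =o[atTop] fun n => (k n : ℝ)) {ε : ℝ} (hε : 0 < ε)
    (j : {j : Fin m // j ≠ 0}) :
    ExpDecay k fun n => (experimentLaw Q n m).real
      {w | ε ≤ refVar (k n) g (Prod.fst ∘ w.1) (Prod.snd ∘ w.1) w.2.1 j} := by
  have := isProbabilityMeasure_resampledLaw (ν := Q.fst) hg
  have : NullSingletonClass (resampledLaw Q.fst g).fst := by rwa [fst_resampledLaw hg]
  refine (expDecay_le_meanSq_sub_smooth hγ ((ae_snd_mem_Icc_resampledLaw hg).mono fun z hz =>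
    abs_le.2 hz) (isRegressionFunction_resampledLaw hg hg1) hkn hlog hε).mono
      (.of_forall fun n => ?_)
  simp only [refVar_of_ne_zero]
  have hsample := measurePreserving_resampledSample (Q := Q) hg n j
  exact measureReal_preimage_le hsample.measurable.aemeasurable hsample.map_eq
    {z | ε ≤ meanSq (g ∘ Prod.fst ∘ z - smooth (k n) (Prod.fst ∘ z) (Prod.snd ∘ z))}

theorem expDecay_meanSq_sub_smooth_le (hγ : IsStoneBound E γ) {M : ℝ}
    (hQ : ∀ᵐ z ∂Q, |z.2| ≤ M) (hr : IsRegressionFunction Q r) (hg : Measurable g) {L : ℝ}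
    (hL : ∀ᵐ x ∂Q.fst, |g x| ≤ L) (hkn : Tendsto (fun n => (k n : ℝ) / n) atTop (𝓝 0))
    (hlog : (fun n : ℕ => Real.log n) =o[atTop] fun n => (k n : ℝ)) {δ : ℝ}
    (hδ : 2 * δ < sqDistQ Q g r) :
    ExpDecay k fun n => (sampleLaw Q n).real
      {z | meanSq (g ∘ Prod.fst ∘ z - smooth (k n) (Prod.fst ∘ z) (Prod.snd ∘ z)) ≤ δ} := by
  obtain ⟨s, hδs, hs⟩ := exists_between hδ
  have hrM := ae_hasSubgaussianMGF_condKernel (hQ.mono fun z hz => abs_le.1 hz) hr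
  have hdiff : ∀ᵐ x ∂Q.fst, |(g - r) x| ≤ L + M := by
    filter_upwards [hL, hrM] with x hx hx'
      using (abs_sub _ _).trans (add_le_add hx (abs_le.2 hx'.1))
  have hsep := ((expDecay_meanSq_le (hg.sub hr.1).aemeasurable hdiff hs).mono_rate
    (eventually_le_of_tendsto_div hkn)).mono <| .of_forall fun n =>
      have hsample := measurePreserving_sampleLaw (T := Prod.fst) (μ := Q) ⟨measurable_fst, rfl⟩ n
      measureReal_preimage_le hsample.measurable.aemeasurable hsample.map_eq _
  have hrisk := expDecay_le_meanSq_sub_smooth hγ hQ hr hkn hlog (ε := (s - 2 * δ) / 2)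
    (by linarith)
  refine (hsep.measureReal_union hrisk).measureReal_mono_ae
    (.of_forall fun n => ae_of_all _ fun z hz => ?_)
  by_contra! hlt
  simp only [Set.mem_union, Set.mem_preimage, Set.mem_ofPred_eq, not_or, not_le] at hlt hz
  have htriangle := meanSq_sub_le
    (g ∘ Prod.fst ∘ z - smooth (k n) (Prod.fst ∘ z) (Prod.snd ∘ z))
    (r ∘ Prod.fst ∘ z - smooth (k n) (Prod.fst ∘ z) (Prod.snd ∘ z))
  rw [sub_sub_sub_cancel_right] at htriangle
  linarith [hlt.1, hlt.2, show s < meanSq (g ∘ Prod.fst ∘ z - r ∘ Prod.fst ∘ z) from hlt.1]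

theorem expDecay_rank_ne (hγ : IsStoneBound E γ) {M : ℝ} (hQ : ∀ᵐ z ∂Q, |z.2| ≤ M)
    (hr : IsRegressionFunction Q r) (hg : Measurable g)
    (hg1 : ∀ᵐ x ∂Q.fst, g x ∈ Set.Icc (-1 : ℝ) 1) (hgr : sqDistQ Q g r ≠ 0)
    (hkn : Tendsto (fun n => (k n : ℝ) / n) atTop (𝓝 0))
    (hlog : (fun n : ℕ => Real.log n) =o[atTop] fun n => (k n : ℝ)) :
    ExpDecay k fun n => (experimentLaw Q n m).real
      {w | rank (k n) g (Prod.fst ∘ w.1) (Prod.snd ∘ w.1) w.2.1 w.2.2 ≠ m} := by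
  have hpos : 0 < sqDistQ Q g r := (integral_nonneg fun x => sq_nonneg _).lt_of_ne' hgr
  have horiginal := (expDecay_meanSq_sub_smooth_le hγ hQ hr hg (hg1.mono fun x hx => abs_le.2 hx)
    hkn hlog (δ := sqDistQ Q g r / 4) (by linarith)).mono <| .of_forall fun n =>
      have hsample : MeasurePreserving Prod.fst (experimentLaw Q n m) (sampleLaw Q n) :=
        measurePreserving_fst
      measureReal_preimage_le hsample.measurable.aemeasurable hsample.map_eq _
  have hresampled : ExpDecay k fun n => (experimentLaw Q n m).real
      (⋃ j : {j : Fin m // j ≠ 0}, {w | sqDistQ Q g r / 4 ≤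
        refVar (k n) g (Prod.fst ∘ w.1) (Prod.snd ∘ w.1) w.2.1 j}) :=
    (ExpDecay.sum fun j _ => expDecay_le_refVar_of_ne_zero hγ hg hg1 hkn hlog
      (div_pos hpos four_pos) j).mono (.of_forall fun n => measureReal_iUnion_fintype_le _)
  refine (horiginal.measureReal_union hresampled).measureReal_mono_ae
    (.of_forall fun n => ae_of_all _ fun w hw => ?_)
  contrapose! hw
  simp only [Set.mem_union, Set.mem_iUnion, Set.mem_preimage, Set.mem_ofPred_eq, not_or,
    not_exists, not_le] at hw
  simp only [Set.mem_ofPred_eq, not_not]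
  refine rank_eq_of_forall_lt _ fun j => (hw.2 j).trans ?_
  rw [refVar_zero]
  exact hw.1

end Experiment

theorem nullSingletonClass_of_dist_ne {E : Type*} [PseudoMetricSpace E] [MeasurableSpace E]
    (ν : Measure E) [SFinite ν]
    (h : ∀ᵐ p ∂ν.prod (ν.prod ν), dist p.1 p.2.1 ≠ dist p.1 p.2.2) : NullSingletonClass ν := by
  refine ⟨fun a => ?_⟩
  have htriple : (ν.prod (ν.prod ν)) ({a} ×ˢ {a} ×ˢ {a}) = 0 := by
    refine measure_mono_null ?_ (ae_iff.1 h)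
    rintro ⟨x, y, z⟩ ⟨hx, hy, hz⟩
    simp only [Set.mem_singleton_iff] at hx hy hz
    simp [hx, hy, hz]
  rw [Measure.prod_prod, Measure.prod_prod] at htriple
  simpa using htriple

section Asymptotics

variable {k : ℕ → ℕ}

theorem log_isLittleO_of_tendsto_sq_div_rpow {s : ℝ} (hs : 0 < s)
    (h : Tendsto (fun n : ℕ => (k n : ℝ) ^ 2 / (n : ℝ) ^ s) atTop atTop) :
    (fun n : ℕ => Real.log n) =o[atTop] fun n => (k n : ℝ) := by
  refine ((isLittleO_log_rpow_atTop (half_pos hs)).comp_tendsto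
    tendsto_natCast_atTop_atTop).trans_isBigO (.of_bound 1 ?_)
  filter_upwards [h.eventually_ge_atTop 1, eventually_gt_atTop 0] with n hn hpos
  have hpos' : (0 : ℝ) < n := by exact_mod_cast hpos
  have hsq : ((n : ℝ) ^ (s / 2)) ^ 2 ≤ (k n : ℝ) ^ 2 := by
    rw [← Real.rpow_mul_natCast hpos'.le, Nat.cast_ofNat, div_mul_cancel₀ s two_ne_zero]
    exact (one_le_div (by positivity)).1 hn
  rw [one_mul]
  exact sq_le_sq.1 hsq

theorem eventually_one_sub_mul_exp_le (hkn : Tendsto (fun n => (k n : ℝ) / n) atTop (𝓝 0))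
    {c C : ℝ} (hc : 0 < c) (hC : 1 ≤ C) (l : ℝ) :
    ∀ᶠ n : ℕ in atTop,
      1 - C * Real.exp (-((k n : ℝ) ^ 2 * l / n)) ≤ 1 - Real.exp (-(c * k n)) := by
  have hlim : Tendsto (fun n => (k n : ℝ) / n * l) atTop (𝓝 0) := by
    simpa using hkn.mul_const l
  filter_upwards [hlim.eventually_le_const hc] with n hn
  have hrate : (k n : ℝ) ^ 2 * l / n ≤ c * k n :=
    calc (k n : ℝ) ^ 2 * l / n = k n / n * l * k n := by ring
      _ ≤ c * k n := by gcongr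
  exact sub_le_sub_left ((Real.exp_le_exp.2 (neg_le_neg hrate)).trans
    (le_mul_of_one_le_left (Real.exp_nonneg _) hC)) _

end Asymptotics

end KNNResampling

open KNNResampling

theorem theorem5_general {E Θ : Type*} [MetricSpace E] [SecondCountableTopology E]
    [MeasurableSpace E] [BorelSpace E] {γ : ℕ} (hγ : IsStoneBound E γ)
    (Q : Measure (E × ℝ)) [IsProbabilityMeasure Q] [NullSingletonClass Q.fst] {M : ℝ}
    (hY : ∀ᵐ z ∂Q, |z.2| ≤ M) (f : Θ → E → ℝ) (θ : Θ) (hf_meas : Measurable (f θ))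
    (hf_range : ∀ᵐ x ∂Q.fst, f θ x ∈ Set.Icc (-1 : ℝ) 1) {r : E → ℝ}
    (hr : IsRegressionFunction Q r) (hθ : sqDistQ Q (f θ) r ≠ 0) {m q : ℕ} [NeZero m]
    (hq : q < m) {k : ℕ → ℕ} (hk : Tendsto (fun n : ℕ => (k n : ℝ) / n) atTop (𝓝 0))
    (hlog : (fun n : ℕ => Real.log n) =o[atTop] fun n => (k n : ℝ)) :
    ∃ c : ℝ, 0 < c ∧ ∀ᶠ n in atTop,
      ∀ {Ω : Type*} [MeasurableSpace Ω] (P : Measure Ω) [IsProbabilityMeasure P]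
        (X : Fin n → Ω → E) (Y : Fin n → Ω → ℝ) (U : Fin n → {j : Fin m // j ≠ 0} → Ω → ℝ)
        (π : Ω → Equiv.Perm (Fin m)),
        HasLaw (fun ω => ((fun i => (X i ω, Y i ω)), (fun i j => U i j ω), π ω))
          (experimentLaw Q n m) P →
        1 - Real.exp (-(c * k n)) ≤ P.real {ω | θ ∉ confidenceRegion f q (k n)
          (fun i => X i ω) (fun i => Y i ω) (fun i j => U i j ω) (π ω)} := by
  obtain ⟨c, hc, hbound⟩ := (expDecay_rank_ne (m := m) hγ hY hr hf_meas hf_range hθ hk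
    hlog).eventually_le_exp (tendsto_atTop_of_log_isLittleO hlog)
  refine ⟨c, hc, hbound.mono fun n hn Ω _ P _ X Y U π hlaw => ?_⟩
  let T := fun ω => ((fun i => (X i ω, Y i ω)), (fun i j => U i j ω), π ω)
  let A := {ω | θ ∈ confidenceRegion f q (k n) (fun i => X i ω) (fun i => Y i ω)
    (fun i j => U i j ω) (π ω)}
  have hA : A ⊆ T ⁻¹' {w | rank (k n) (f θ) (Prod.fst ∘ w.1) (Prod.snd ∘ w.1) w.2.1 w.2.2 ≠ m} :=
    fun ω hω => (lt_of_le_of_lt hω hq).ne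
  have hbad : P.real A ≤ Real.exp (-(c * k n)) := (measureReal_mono hA).trans <|
    (measureReal_preimage_le hlaw.aemeasurable hlaw.map_eq _).trans hn
  have hcover : P.real Set.univ ≤ P.real A + P.real Aᶜ := by
    simpa only [Set.union_compl_self] using measureReal_union_le (μ := P) A Aᶜ
  rw [probReal_univ] at hcover
  exact sub_le_iff_le_add'.2 (hcover.trans (add_le_add hbad le_rfl))

theorem theorem5 {d : ℕ} {𝕏 : Set (EuclideanSpace ℝ (Fin d))} {Θ : Type*}
    -- the distribution of `(X, Y)`, with labels in `{1, -1}`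
    (Q : Measure (𝕏 × ℝ)) [IsProbabilityMeasure Q]
    (hY : ∀ᵐ z ∂Q, z.2 = 1 ∨ z.2 = -1)
    -- the model class contains the regression function, and the parametrization is injective
    (f : Θ → 𝕏 → ℝ) (hf_meas : ∀ θ, Measurable (f θ))
    (hf_range : ∀ θ x, f θ x ∈ Set.Icc (-1 : ℝ) 1)
    (hf_inj : ∀ θ₁ θ₂, θ₁ ≠ θ₂ → KNNResampling.sqDistQ Q (f θ₁) (f θ₂) ≠ 0)
    (θstar : Θ) (hstar : KNNResampling.IsRegressionFunction Q (f θstar))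
    -- the parameters of the method
    (m q : ℕ) [NeZero m] (hq : q < m) (k : ℕ → ℕ)
    (hk : Tendsto (fun n : ℕ => (k n : ℝ) / (n : ℝ)) atTop (𝓝 0))
    (hk' : ∃ δ : ℝ, 0 < δ ∧
      Tendsto (fun n : ℕ => (k n : ℝ) ^ 2 / (n : ℝ) ^ (1 + δ)) atTop atTop)
    -- distances from `X` to independent copies of `X` are almost surely different
    (hties : ∀ᵐ p ∂(Q.fst.prod (Q.fst.prod Q.fst)),
      ‖(p.1 : EuclideanSpace ℝ (Fin d)) - p.2.1‖ ≠ ‖(p.1 : EuclideanSpace ℝ (Fin d)) - p.2.2‖)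
    (θ : Θ) (hθ : θ ≠ θstar) :
    ∃ N₀ : ℕ, ∀ n : ℕ, N₀ ≤ n →
      ∀ {Ω : Type*} [MeasurableSpace Ω] (P : Measure Ω) [IsProbabilityMeasure P]
        (X : Fin n → Ω → 𝕏) (Y : Fin n → Ω → ℝ)
        (U : Fin n → {j : Fin m // j ≠ 0} → Ω → ℝ) (π : Ω → Equiv.Perm (Fin m)),
        HasLaw
          (fun ω => ((fun i => (X i ω, Y i ω)), (fun i j => U i j ω), π ω))
          (KNNResampling.experimentLaw Q n m) P →
        1 - (4 + 2 * ((m : ℝ) - 1)) *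
            Real.exp (-((k n : ℝ) ^ 2 *
              (KNNResampling.distQ Q (f θ) (f θstar) ^ 4 / (2 * 48 ^ 2)) / (n : ℝ)))
          ≤ P.real {ω | θ ∉ KNNResampling.confidenceRegion f q (k n)
              (fun i => X i ω) (fun i => Y i ω) (fun i j => U i j ω) (π ω)} := by
  obtain ⟨s, hs, hk_sq⟩ := hk'
  have : NullSingletonClass Q.fst := nullSingletonClass_of_dist_ne _ <| by
    simpa only [Subtype.dist_eq, dist_eq_norm] using hties
  obtain ⟨γ, hγ⟩ := exists_isStoneBound (EuclideanSpace ℝ (Fin d))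
  obtain ⟨c, hc, hbound⟩ := theorem5_general (hγ.subtype 𝕏) Q (M := 1)
    (hY.mono fun z hz => by rcases hz with h | h <;> simp [h]) f θ (hf_meas θ)
    (ae_of_all _ (hf_range θ)) hstar (hf_inj θ θstar hθ) hq hk
    (log_isLittleO_of_tendsto_sq_div_rpow (by linarith) hk_sq)
  have hC : 1 ≤ 4 + 2 * ((m : ℝ) - 1) := by
    linarith [show (1 : ℝ) ≤ m from mod_cast NeZero.one_le (n := m)]
  refine eventually_atTop.1 ?_
  filter_upwards [hbound, eventually_one_sub_mul_exp_le hk hc hC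
    (distQ Q (f θ) (f θstar) ^ 4 / (2 * 48 ^ 2))] with n hn hle Ω _ P _ X Y U π hlaw
  exact hle.trans (hn P X Y U π hlaw)
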